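/- Let $K$ be a field and $\lambda\in K$. A tree is a rooted tree, edges directed towards the root, with vertices labelled by $1,\dots,n$; the height $h(v)$ of a vertex is its distance to the root. Let $\mathcal{RT}(n)$ be the vector space spanned by the trees with $n$ vertices. A weighted tree is a tree each of whose vertices $v$ carries a weight $|v|\in\mathbb N^*$; put $|T|=\sum_v|v|$ and $d(T)=\sum_v|v|\,h(v)$ (potential energy). For trees $S$ ($n$ vertices) and $T$ ($m$ vertices), a vertex $v$ of $S$, and a map $f:E(S,v)\to v(T)$ from the set of edges of $S$ arriving at $v$ to the set of vertices of $T$, let $S\circ_v^fT$ be the tree with $n+m-1$ vertices obtained by replacing $v$ by $T$ and attaching each edge $e\in E(S,v)$ to the vertex $f(e)$; the labels of $T$ are inserted as a block in place of the label of $v$, and the other vertices keep their weights. Let $f_0$ be the constant map with value the root of $T$. For weighted trees set $$S\circ_{v,\lambda}T=\sum_{f:E(S,v)\to v(T)}\lambda^{d(S\circ_v^fT)-d(S\circ_v^{f_0}T)}\,S\circ_v^fT\quad\text{if }|T|=|v|,\qquad S\circ_{v,\lambda}T=0\ \text{ otherwise}$$ (with $0^0=1$). Let $\mathcal O^\lambda_n=\prod_{a\in(\mathbb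 N^*)^n}\mathcal O^\lambda_{n,a}$, where $\mathcal O^\lambda_{n,a}$ is spanned by the weighted trees whose vertex labelled $j$ has weight $a_j$ for all $j$. Extend $\circ_{i,\lambda}$ bilinearly and componentwise to these products: the component of $X\circ_{i,\lambda}Y$ in degree $(a_1,\dots,a_{i-1},b_1,\dots,b_m,a_{i+1},\dots,a_n)$ with $a_i=\sum_j b_j$ is $X_a\circ_{i,\lambda}Y_b$. Let $S_n$ act on the right by permuting labels (the vertex of $T.\sigma$ with label $k$ is the vertex of $T$ with label $\sigma(k)$), and let $\mathbf 1=\sum_{k\ge1}(\text{one-vertex tree of weight }k)$. **Theorem.** (1) $d(S\circ_v^fT)\ge d(S\circ_v^{f_0}T)$ always, and $\mathcal O^\lambda$ is a multigraded operad, that is: * *(operad)* the $S_n$-actions are right actions by linear maps, the compositions are bilinear, and, for all $x,y,z$ of arities $n,m,l$, one has nested associativity $(x\circ_iy)\circ_{i+j-1}z=x\circ_i(y\circ_jz)$ for $1\le i\le n$, $1\le j\le m$; disjoint associativity $(x\circ_iy)\circ_{j+m-1}z=(x\circ_jz)\circ_iy$ for $1\le i<j\le n$; the unit laws $\mathbf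 1\circ_1x=x=x\circ_i\mathbf 1$; and equivariance $(x.\sigma)\circ_i(y.\tau)=(x\circ_{\sigma(i)}y).\rho$, where $\rho\in S_{n+m-1}$ permutes the block inserted at $i$ by $\tau$ and the blocks by $\sigma$; * *(multigrading)* $\mathcal O^\lambda_{n,a_1,\dots,a_n}.\sigma=\mathcal O^\lambda_{n,a_{\sigma(1)},\dots,a_{\sigma(n)}}$; and $\circ_i$ maps $\mathcal O^\lambda_{n,a}\times\mathcal O^\lambda_{m,b}$ to $\mathcal O^\lambda_{n+m-1,(a_1,\dots,a_{i-1},b_1,\dots,b_m,a_{i+1},\dots,a_n)}$ and is zero there if $\sum_jb_j\ne a_i$. (2) Forgetting the grading gives the pre-Lie operad ($\mathcal{RT}$ with $S\circ_iT=\sum_fS\circ_i^fT$) for $\lambda=1$ and the operad NAP ($\mathcal{RT}$ with $S\circ_iT=S\circ_i^{f_0}T$) for $\lambda=0$, both with unit the one-vertex tree and action by permutation of labels. That is: each of these is an operad; whenever $\sum_jb_j=a_i$, under the identifications $\mathcal O^\lambda_{n,a}=\mathcal{RT}(n)$ that forget the weights, the composition $\mathcal O^\lambda_{n,a}\times\mathcal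 O^\lambda_{m,b}\to\mathcal O^\lambda_{n+m-1,\ldots}$ is the pre-Lie composition if $\lambda=1$ and the NAP composition if $\lambda=0$; and $t\mapsto\sum_{\mu\in(\mathbb N^*)^n}(t,\mu)$ is an injective morphism of operads from the pre-Lie operad to $\mathcal O^1$ and from NAP to $\mathcal O^0$ (compatible with compositions, units and actions). -/

import Mathlib

universe u

noncomputable section

/-! ## Labelled rooted trees -/

/-- A rooted tree with vertex set `I` (so the vertices are labelled by `I`), given by its root and
the map sending each vertex other than the root to the target of its unique outgoing edge.
The root, which is the departure of no edge, is sent to itself by convention, and following the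
edges from any vertex leads to the root. -/
@[ext]
structure LabelledRootedTree (I : Type) where
  root : I
  parent : I → I
  parent_root : parent root = root
  reaches : ∀ v, ∃ k : ℕ, parent^[k] v = root

namespace LabelledRootedTree

variable {I J : Type}

/-- The height of a vertex: its distance to the root, counting edges. -/
def height [DecidableEq I] (T : LabelledRootedTree I) (v : I) : ℕ :=
  Nat.find (T.reaches v)

/-- The set `E(T, v)` of edges of `T` arriving at `v`; an edge is identified with its source. -/
abbrev Incoming (T : LabelledRootedTree I) (v : I) : Type :=
  {x : I // x ≠ T.root ∧ T.parent x = v}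

/-- The potential energy `d(T) = ∑ v, |v| h(v)` of a tree with vertex weights `w`. -/
def energy [Fintype I] [DecidableEq I] (T : LabelledRootedTree I) (w : I → ℕ+) : ℕ :=
  ∑ v, (w v : ℕ) * T.height v

/-- Transport of a tree along a bijection of the sets of labels. -/
def relabel (e : I ≃ J) (T : LabelledRootedTree I) : LabelledRootedTree J where
  root := e T.root
  parent := fun y => e (T.parent (e.symm y))
  parent_root := by simp [T.parent_root]
  reaches := by
    intro v
    obtain ⟨k, hk⟩ := T.reaches (e.symm v)
    refine ⟨k, ?_⟩
    have h : ∀ (k : ℕ) (x : I),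
        (fun y => e (T.parent (e.symm y)))^[k] (e x) = e (T.parent^[k] x) := by
      intro k
      induction k with
      | zero => intro x; rfl
      | succ k ih => intro x; simp [Function.iterate_succ_apply, ih]
    have := h k (e.symm v)
    rw [Equiv.apply_symm_apply] at this
    rw [this, hk]

/-- The root of the tree obtained by substituting `T` for the vertex `v` of `S`. -/
def substRoot [DecidableEq I] (S : LabelledRootedTree I) (v : I) (T : LabelledRootedTree J) :
    {x : I // x ≠ v} ⊕ J :=
  if h : S.root = v then Sum.inr T.root else Sum.inl ⟨S.root, h⟩

/-- The parent map of the tree obtained by substituting `T` for the vertex `v` of `S` and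
reattaching the edges entering `v` according to `f`. -/
def substParent [DecidableEq I] [DecidableEq J] (S : LabelledRootedTree I) (v : I)
    (T : LabelledRootedTree J) (f : S.Incoming v → J) :
    {x : I // x ≠ v} ⊕ J → {x : I // x ≠ v} ⊕ J
  | Sum.inl x =>
      if hr : x.1 = S.root then Sum.inl x
      else if h : S.parent x.1 = v then Sum.inr (f ⟨x.1, hr, h⟩)
      else Sum.inl ⟨S.parent x.1, h⟩
  | Sum.inr y =>
      if y = T.root then
        if h : S.parent v = v then Sum.inr T.root else Sum.inl ⟨S.parent v, h⟩
      else Sum.inr (T.parent y)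

theorem eq_root_of_parent_eq (S : LabelledRootedTree I) {v : I} (h : S.parent v = v) :
    v = S.root := by
  obtain ⟨k, hk⟩ := S.reaches v
  rwa [Function.iterate_fixed h] at hk

/-- The tree `S ∘_v^f T`: the vertex `v` of `S` is replaced by the tree `T`, and each edge `e` of
`S` arriving at `v` is reattached to the vertex `f e` of `T`. -/
def subst [DecidableEq I] [DecidableEq J] (S : LabelledRootedTree I) (v : I)
    (T : LabelledRootedTree J) (f : S.Incoming v → J) :
    LabelledRootedTree ({x : I // x ≠ v} ⊕ J) where
  root := S.substRoot v T
  parent := S.substParent v T f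
  parent_root := by
    by_cases h : S.root = v
    · have hp : S.parent v = v := by rw [← h]; exact S.parent_root
      simp [substRoot, substParent, h, hp]
    · simp [substRoot, substParent, h]
  reaches := by
    have step : ∀ z, (∃ k : ℕ, (S.substParent v T f)^[k] (S.substParent v T f z)
        = S.substRoot v T) → ∃ k : ℕ, (S.substParent v T f)^[k] z = S.substRoot v T := by
      rintro z ⟨k, hk⟩
      exact ⟨k + 1, hk⟩
    have inner : (∃ k : ℕ, (S.substParent v T f)^[k] (Sum.inr T.root) = S.substRoot v T) →
        ∀ (n : ℕ) (y : J), T.parent^[n] y = T.root →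
          ∃ k : ℕ, (S.substParent v T f)^[k] (Sum.inr y) = S.substRoot v T := by
      intro h0 n
      induction n with
      | zero =>
        intro y hy
        have hy' : y = T.root := hy
        rw [hy']
        exact h0
      | succ n ih =>
        intro y hy
        by_cases hr : y = T.root
        · rw [hr]; exact h0
        · apply step
          have : S.substParent v T f (Sum.inr y) = Sum.inr (T.parent y) := by
            simp [substParent, hr]
          rw [this]
          exact ih _ hy
    have outer : ∀ (n : ℕ) (x : I), S.parent^[n] x = S.root →
        (∀ h : x ≠ v, ∃ k : ℕ, (S.substParent v T f)^[k] (Sum.inl ⟨x, h⟩) = S.substRoot v T) ∧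
        (x = v → ∃ k : ℕ, (S.substParent v T f)^[k] (Sum.inr T.root) = S.substRoot v T) := by
      have base : ∀ x : I, x = S.root →
          (∀ h : x ≠ v, ∃ k : ℕ, (S.substParent v T f)^[k] (Sum.inl ⟨x, h⟩)
            = S.substRoot v T) ∧
          (x = v → ∃ k : ℕ, (S.substParent v T f)^[k] (Sum.inr T.root)
            = S.substRoot v T) := by
        intro x hx
        subst hx
        refine ⟨fun h => ⟨0, ?_⟩, fun h => ⟨0, ?_⟩⟩
        · simp [substRoot, h]
        · simp [substRoot, h]
      intro n
      induction n with
      | zero => intro x hx; exact base x hx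
      | succ n ih =>
        intro x hx
        by_cases hr : x = S.root
        · exact base x hr
        obtain ⟨ih1, ih2⟩ := ih (S.parent x) hx
        refine ⟨fun h => ?_, fun h => ?_⟩
        · apply step
          by_cases hp : S.parent x = v
          · have : S.substParent v T f (Sum.inl ⟨x, h⟩) = Sum.inr (f ⟨x, hr, hp⟩) := by
              simp [substParent, hr, hp]
            rw [this]
            obtain ⟨m, hm⟩ := T.reaches (f ⟨x, hr, hp⟩)
            exact inner (ih2 hp) m _ hm
          · have : S.substParent v T f (Sum.inl ⟨x, h⟩) = Sum.inl ⟨S.parent x, hp⟩ := by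
              simp [substParent, hr, hp]
            rw [this]
            exact ih1 hp
        · subst h
          have hp : S.parent x ≠ x := fun hp => hr (S.eq_root_of_parent_eq hp)
          apply step
          have : S.substParent x T f (Sum.inr T.root) = Sum.inl ⟨S.parent x, hp⟩ := by
            simp [substParent, hp]
          rw [this]
          exact ih1 hp
    rintro (⟨x, hx⟩ | y)
    · obtain ⟨n, hn⟩ := S.reaches x
      exact (outer n x hn).1 hx
    · obtain ⟨n, hn⟩ := S.reaches v
      obtain ⟨m, hm⟩ := T.reaches y
      exact inner ((outer n v hn).2 rfl) m y hm

/-- The map `f₀` reattaching every edge of `S` arriving at `v` to the root of `T`. -/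
def toRoot (S : LabelledRootedTree I) (v : I) (T : LabelledRootedTree J) : S.Incoming v → J :=
  fun _ => T.root

/-- The tree with a single vertex. -/
def dot : LabelledRootedTree (Fin 1) where
  root := 0
  parent := id
  parent_root := rfl
  reaches := fun _ => ⟨0, Subsingleton.elim _ _⟩

end LabelledRootedTree

/-! ## Relabelling conventions for partial compositions -/

/-- The order in which `{1, …, n} \ {i}` and `{1, …, m}` are merged to `{1, …, n + m - 1}`
(with labels counted from `0` in `Fin`): the block `Fin m` is inserted in place of `i`. -/
def insertEquiv {n : ℕ} (m : ℕ) (i : Fin n) : {x : Fin n // x ≠ i} ⊕ Fin m ≃ Fin (n + m - 1) where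
  toFun
    | Sum.inl x =>
        if _h : x.1.1 < i.1 then ⟨x.1.1, by have := i.2; have := x.1.2; omega⟩
        else ⟨x.1.1 + m - 1, by
          have := x.1.2; have := i.2
          have : x.1.1 ≠ i.1 := fun h => x.2 (Fin.ext h)
          omega⟩
    | Sum.inr y => ⟨i.1 + y.1, by have := i.2; have := y.2; omega⟩
  invFun k :=
    if h₁ : k.1 < i.1 then
      Sum.inl ⟨⟨k.1, by have := i.2; omega⟩, fun h => by
        have := congrArg Fin.val h; dsimp only at this; omega⟩
    else if h₂ : k.1 < i.1 + m then Sum.inr ⟨k.1 - i.1, by omega⟩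
    else Sum.inl ⟨⟨k.1 + 1 - m, by have := k.2; omega⟩, fun h => by
        have := congrArg Fin.val h; dsimp only at this; omega⟩
  left_inv := by
    rintro (⟨⟨x, hx⟩, hxi⟩ | ⟨y, hy⟩)
    · have hne : x ≠ i.1 := fun h => hxi (Fin.ext h)
      by_cases h : x < i.1
      · simp [h]
      · have h₁ : ¬ x + m - 1 < i.1 := by omega
        have h₂ : ¬ x + m - 1 < i.1 + m := by omega
        simp only [h, if_false, h₁, h₂, dif_neg, not_false_eq_true]
        congr 2
        apply Fin.ext
        simp only
        omega
    · simp [hy]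
  right_inv := by
    rintro ⟨k, hk⟩
    by_cases h₁ : k < i.1
    · simp [h₁]
    · by_cases h₂ : k < i.1 + m
      · simp only [h₁, h₂, dif_neg, not_false_eq_true, dif_pos]
        apply Fin.ext
        simp only
        omega
      · have h₃ : ¬ k + 1 - m < i.1 := by omega
        simp only [h₁, h₂, h₃, dif_neg, not_false_eq_true, if_false]
        apply Fin.ext
        simp only
        omega

/-- `(a₁, …, a_{i-1}, b₁, …, b_m, a_{i+1}, …, a_n)`. -/
def insertDegree {n m : ℕ} (i : Fin n) (a : Fin n → ℕ+) (b : Fin m → ℕ+) :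
    Fin (n + m - 1) → ℕ+ :=
  fun k => Sum.elim (fun x : {x : Fin n // x ≠ i} => a x.1) b ((insertEquiv m i).symm k)

/-- The sum `b₁ + ⋯ + b_m`, a natural number. -/
def totalDegree {m : ℕ} (b : Fin m → ℕ+) : ℕ := ∑ j, (b j : ℕ)

/-- The permutation `ρ(σ, τ)` of `n + m - 1` elements: `τ` acts inside the block inserted at
position `i`, and `σ` acts on the blocks (so that the block moves to position `σ i`). -/
def blockPerm {n m : ℕ} (i : Fin n) (σ : Equiv.Perm (Fin n)) (τ : Equiv.Perm (Fin m)) :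
    Equiv.Perm (Fin (n + m - 1)) :=
  (insertEquiv m i).symm.trans
    ((Equiv.sumCongr (σ.subtypeEquiv (fun _ => not_congr σ.injective.eq_iff.symm)) τ).trans
      (insertEquiv m (σ i)))

/-! ## Operads and multigraded operads -/

/-- The data of an operad of `K`-vector spaces in terms of partial compositions. -/
structure OperadData (K : Type u) [Field K] where
  carrier : ℕ → Type u
  [addCommGroup : ∀ n, AddCommGroup (carrier n)]
  [module : ∀ n, Module K (carrier n)]
  /-- The right action `x ↦ x.σ` of the symmetric group. -/
  act : ∀ {n : ℕ}, Equiv.Perm (Fin n) → carrier n →ₗ[K] carrier n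
  unit : carrier 1
  comp : ∀ {n m : ℕ}, Fin n → carrier n →ₗ[K] carrier m →ₗ[K] carrier (n + m - 1)

attribute [instance] OperadData.addCommGroup OperadData.module

namespace OperadData

variable {K : Type u} [Field K]

/-- Identification of equal arities. -/
def castArity (P : OperadData K) {n m : ℕ} (h : n = m) (x : P.carrier n) : P.carrier m :=
  h ▸ x

/-- The axioms of an operad. Labels are counted from `0`, so that the composition index written
`i + j - 1` when counting from `1` becomes `i + j`. -/
structure IsOperad (P : OperadData K) : Prop where
  act_one : ∀ {n : ℕ} (x : P.carrier n), P.act 1 x = x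
  act_mul : ∀ {n : ℕ} (σ τ : Equiv.Perm (Fin n)) (x : P.carrier n),
    P.act (σ * τ) x = P.act τ (P.act σ x)
  nested_assoc : ∀ {n m l : ℕ} (i : Fin n) (j : Fin m)
    (x : P.carrier n) (y : P.carrier m) (z : P.carrier l),
    P.castArity (by have := i.2; have := j.2; omega)
      (P.comp (⟨i.1 + j.1, by have := i.2; have := j.2; omega⟩ : Fin (n + m - 1))
        (P.comp i x y) z) =
      P.comp i x (P.comp j y z)
  disjoint_assoc : ∀ {n m l : ℕ} (i j : Fin n) (hij : i < j)
    (x : P.carrier n) (y : P.carrier m) (z : P.carrier l),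
    P.castArity (by have := j.2; have : i.1 < j.1 := hij; omega)
      (P.comp (⟨j.1 + m - 1, by have := j.2; have : i.1 < j.1 := hij; omega⟩ : Fin (n + m - 1))
        (P.comp i x y) z) =
      P.comp (⟨i.1, by have := j.2; have : i.1 < j.1 := hij; omega⟩ : Fin (n + l - 1))
        (P.comp j x z) y
  unit_comp : ∀ {m : ℕ} (x : P.carrier m),
    P.castArity (by omega) (P.comp (0 : Fin 1) P.unit x) = x
  comp_unit : ∀ {n : ℕ} (i : Fin n) (x : P.carrier n),
    P.castArity (by omega) (P.comp i x P.unit) = x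
  equivariant : ∀ {n m : ℕ} (i : Fin n) (σ : Equiv.Perm (Fin n)) (τ : Equiv.Perm (Fin m))
    (x : P.carrier n) (y : P.carrier m),
    P.comp i (P.act σ x) (P.act τ y) = P.act (blockPerm i σ τ) (P.comp (σ i) x y)

/-- Morphisms of operads. -/
structure IsMorphism (P Q : OperadData K) (φ : ∀ n, P.carrier n →ₗ[K] Q.carrier n) : Prop where
  map_act : ∀ {n : ℕ} (σ : Equiv.Perm (Fin n)) (x : P.carrier n),
    φ n (P.act σ x) = Q.act σ (φ n x)
  map_unit : φ 1 P.unit = Q.unit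
  map_comp : ∀ {n m : ℕ} (i : Fin n) (x : P.carrier n) (y : P.carrier m),
    φ (n + m - 1) (P.comp i x y) = Q.comp i (φ n x) (φ m y)

/-- A decomposition of each `P(n)` as a direct product of spaces indexed by
`(a₁, …, a_n)`, the `a_j` being positive integers. -/
structure Multigrading (P : OperadData K) where
  component : ∀ n : ℕ, (Fin n → ℕ+) → Type u
  [addCommGroup : ∀ n a, AddCommGroup (component n a)]
  [module : ∀ n a, Module K (component n a)]
  decompose : ∀ n : ℕ, P.carrier n ≃ₗ[K] (∀ a : Fin n → ℕ+, component n a)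

attribute [instance] Multigrading.addCommGroup Multigrading.module

namespace Multigrading

variable {P : OperadData K}

/-- The factor of multidegree `a` as a subspace of `P(n)`: the elements all of whose components
of multidegree other than `a` vanish. -/
def homogeneous (G : P.Multigrading) {n : ℕ} (a : Fin n → ℕ+) : Submodule K (P.carrier n) where
  carrier := {x | ∀ b, b ≠ a → G.decompose n x b = 0}
  add_mem' := by
    intro x y hx hy b hb
    simp [hx b hb, hy b hb]
  zero_mem' := by
    intro b _
    simp
  smul_mem' := by
    intro r x hx b hb
    simp [hx b hb]

/-- The part of multidegree `a` of an element of `P(n)`. -/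
def part (G : P.Multigrading) {n : ℕ} (a : Fin n → ℕ+) (x : P.carrier n) : P.carrier n :=
  (G.decompose n).symm (Pi.single a (G.decompose n x a))

/-- The conditions on the decomposition that make an operad multigraded. -/
structure IsMultigraded (G : P.Multigrading) : Prop where
  isOperad : P.IsOperad
  map_act : ∀ {n : ℕ} (σ : Equiv.Perm (Fin n)) (a : Fin n → ℕ+),
    (G.homogeneous a).map (P.act σ) = G.homogeneous (fun k => a (σ k))
  comp_mem : ∀ {n m : ℕ} (i : Fin n) (a : Fin n → ℕ+) (b : Fin m → ℕ+)
    (x : P.carrier n) (y : P.carrier m), x ∈ G.homogeneous a → y ∈ G.homogeneous b →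
    P.comp i x y ∈ G.homogeneous (insertDegree i a b)
  comp_eq_zero : ∀ {n m : ℕ} (i : Fin n) (a : Fin n → ℕ+) (b : Fin m → ℕ+)
    (x : P.carrier n) (y : P.carrier m), x ∈ G.homogeneous a → y ∈ G.homogeneous b →
    totalDegree b ≠ (a i : ℕ) → P.comp i x y = 0

end Multigrading

end OperadData

/-! ## The operads of rooted trees -/

section Trees

variable (K : Type u) [Field K]

/-- The space `RT(n)` spanned by the rooted trees with vertices labelled by `n` labels. -/
abbrev TreeSpace (n : ℕ) : Type u := LabelledRootedTree (Fin n) →₀ K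

variable {K}

/-- The tree `S ∘_i^f T` with its vertices labelled by `1, …, n + m - 1`. -/
def treeInsert {n m : ℕ} (i : Fin n) (S : LabelledRootedTree (Fin n))
    (T : LabelledRootedTree (Fin m)) (f : S.Incoming i → Fin m) :
    LabelledRootedTree (Fin (n + m - 1)) :=
  (S.subst i T f).relabel (insertEquiv m i)

/-- Right action of permutations on trees: in `T.σ` the vertex with label `k` is the vertex of
`T` with label `σ k`. -/
def treeAct {n : ℕ} (σ : Equiv.Perm (Fin n)) : TreeSpace K n →ₗ[K] TreeSpace K n :=
  Finsupp.lmapDomain K K (LabelledRootedTree.relabel σ.symm)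

/-- The bilinear extension of a composition given on trees. -/
def bilinearExtension {n m l : ℕ}
    (w : LabelledRootedTree (Fin n) → LabelledRootedTree (Fin m) → TreeSpace K l) :
    TreeSpace K n →ₗ[K] TreeSpace K m →ₗ[K] TreeSpace K l :=
  Finsupp.linearCombination K fun S => Finsupp.linearCombination K fun T => w S T

variable (K)

/-- The pre-Lie operad of rooted trees: `S ∘_i T = ∑_f S ∘_i^f T`. -/
def preLieData : OperadData K where
  carrier := TreeSpace K
  act := treeAct
  unit := Finsupp.single LabelledRootedTree.dot 1
  comp := fun i => bilinearExtension fun S T =>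
    ∑ f : S.Incoming i → Fin _, Finsupp.single (treeInsert i S T f) 1

/-- The operad NAP: `S ∘_i T = S ∘_i^{f₀} T`. -/
def napData : OperadData K where
  carrier := TreeSpace K
  act := treeAct
  unit := Finsupp.single LabelledRootedTree.dot 1
  comp := fun i => bilinearExtension fun S T =>
    Finsupp.single (treeInsert i S T (S.toRoot i T)) 1

/-- The space `O^λ(n)`: the direct product, over the families `a` of weights of the vertices, of
the spaces spanned by the trees whose vertices have weights `a`. -/
abbrev WeightedTreeSpace (n : ℕ) : Type u := (Fin n → ℕ+) → TreeSpace K n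

variable {K}

/-- The tree `T` with vertex weights `a`, as an element of `O^λ(n)`. -/
def weightedTree {n : ℕ} (T : LabelledRootedTree (Fin n)) (a : Fin n → ℕ+) :
    WeightedTreeSpace K n :=
  Pi.single a (Finsupp.single T 1)

/-- The potential energy of the tree `S ∘_i^f T` when `S`, `T` carry the weights `a`, `b`. -/
def insertEnergy {n m : ℕ} (i : Fin n) (S : LabelledRootedTree (Fin n)) (a : Fin n → ℕ+)
    (T : LabelledRootedTree (Fin m)) (b : Fin m → ℕ+) (f : S.Incoming i → Fin m) : ℕ :=
  (treeInsert i S T f).energy (insertDegree i a b)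

/-- The coefficient `λ^{d(S ∘^f T) - d(S ∘^{f₀} T)}`. -/
def insertCoeff (lam : K) {n m : ℕ} (i : Fin n) (S : LabelledRootedTree (Fin n)) (a : Fin n → ℕ+)
    (T : LabelledRootedTree (Fin m)) (b : Fin m → ℕ+) (f : S.Incoming i → Fin m) : K :=
  lam ^ (insertEnergy i S a T b f - insertEnergy i S a T b (S.toRoot i T))

/-- The partial composition `S ∘_{i,λ} T` of two weighted trees. -/
def weightedTreeComp (lam : K) {n m : ℕ} (i : Fin n) (S : LabelledRootedTree (Fin n))
    (a : Fin n → ℕ+) (T : LabelledRootedTree (Fin m)) (b : Fin m → ℕ+) :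
    WeightedTreeSpace K (n + m - 1) :=
  if totalDegree b = (a i : ℕ) then
    ∑ f : S.Incoming i → Fin m,
      insertCoeff lam i S a T b f • weightedTree (treeInsert i S T f) (insertDegree i a b)
  else 0

/-- For weights `c` of `n + m - 1` vertices, the weights of the block of `m` vertices inserted
at `i`. -/
def innerDegree {n m : ℕ} (i : Fin n) (c : Fin (n + m - 1) → ℕ+) : Fin m → ℕ+ :=
  fun y => c (insertEquiv m i (Sum.inr y))

/-- For weights `c` of `n + m - 1` vertices, the weights of the `n` vertices obtained when the
block of `m` vertices inserted at `i` is contracted to one vertex carrying the total weight of the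
block. (When `m = 0` the value at `i` is irrelevant, since there is no tree without vertices.) -/
def outerDegree {n m : ℕ} (i : Fin n) (c : Fin (n + m - 1) → ℕ+) : Fin n → ℕ+ :=
  fun x => if h : x = i then (totalDegree (innerDegree (m := m) i c)).toPNat'
    else c (insertEquiv m i (Sum.inl ⟨x, h⟩))

/-- The data of the operad `O^λ`. An element of the direct product is regarded as a possibly
infinite sum of weighted trees, and the partial compositions of weighted trees are extended to
such sums. Only the products of the components of multidegrees `outerDegree i c` and
`innerDegree i c` contribute to the component of multidegree `c` of a composition. -/
def deformedData (lam : K) : OperadData K where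
  carrier := WeightedTreeSpace K
  act := fun σ => LinearMap.pi fun c =>
    (treeAct σ).comp (LinearMap.proj fun k => c (σ.symm k))
  unit := fun _ => Finsupp.single LabelledRootedTree.dot 1
  comp := fun {n m} i => LinearMap.mk₂ K
    (fun x y c => bilinearExtension
      (fun S T => weightedTreeComp lam i S (outerDegree (m := m) i c) T (innerDegree i c) c)
      (x (outerDegree (m := m) i c)) (y (innerDegree i c)))
    (fun x x' y => by funext c; simp)
    (fun r x y => by funext c; simp)
    (fun x y y' => by funext c; simp)
    (fun r x y => by funext c; simp)

/-- The multigrading of `O^λ` by the weights of the vertices. -/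
def deformedMultigrading (lam : K) : (deformedData lam).Multigrading where
  component := fun n _ => TreeSpace K n
  decompose := fun n => LinearEquiv.refl K (WeightedTreeSpace K n)

variable (K)

/-- The map `t ↦ ∑_a (t, a)`, the sum being over all families `a` of weights of the vertices. -/
def sumOverWeights (n : ℕ) : TreeSpace K n →ₗ[K] WeightedTreeSpace K n :=
  LinearMap.pi fun _ => LinearMap.id

end Trees

end

noncomputable section

open LabelledRootedTree

/-! ## Basic facts about rooted trees -/

namespace LabelledRootedTree

variable {I J L : Type}

/-! A tree `U` on the merged labels is `S ∘_v^f T` for some `f` exactly when the labels of `T` span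
a copy of `T` inside `U` and contracting this block to `v` turns `U` into `S`; this relation is
`IsSubst`. Given the partition of the labels, `U` determines `S`, `T` and `f`
(`IsSubst.outer_unique`, `IsSubst.inner_unique`, `subst_injective`). Hence the coefficient of a
composition at `U` is a single product or zero (`graft_eq`, `graft_eq_zero`), and statements about
sums over reattachments become statements about contractions of one fixed tree.

When every edge is reattached to the root of `T`, the vertices of `S` keep their heights and the
block is raised by the height of `v`. Since `|T| = |v|`, this gives `d(S ∘^{f₀} T) = d(S) + d(T)`
(`energy_subst_toRoot`), so the exponent of `λ` is `d(U) - d(S) - d(T)`. It is nonnegative because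
contraction does not increase heights. In an iterated composition of `X`, `Y`, `Z` the energy of the
intermediate tree cancels, leaving `d(U) - d(X) - d(Y) - d(Z)` for either bracketing. Associativity
is thereby reduced to contracting nested blocks in one or two stages (`exists_nested_inner`,
`exists_nested_outer`) and disjoint blocks in either order (`exists_disjoint`).

For `λ = 1` all coefficients are `1`. For `λ = 0` only exponent `0` survives, which forces `f = f₀`
(`energy_subst_toRoot_lt`). So `sumOverWeights` is an injective morphism from the pre-Lie operad,
respectively NAP, and their operad axioms are pulled back along it. -/

theorem parent_eq_self_iff (T : LabelledRootedTree I) {v : I} : T.parent v = v ↔ v = T.root :=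
  ⟨T.eq_root_of_parent_eq, fun h => by rw [h, T.parent_root]⟩

/-- The root is the only fixed point of the parent map, so the parent map alone determines the tree.
-/
theorem parent_injective :
    Function.Injective (parent : LabelledRootedTree I → I → I) := by
  intro S T h
  have hr : S.root = T.root := by
    rw [← T.parent_eq_self_iff, ← h, S.parent_root]
  exact LabelledRootedTree.ext hr h

theorem parent_induction (T : LabelledRootedTree I) {P : I → Prop} (root : P T.root)
    (step : ∀ v, v ≠ T.root → P (T.parent v) → P v) (v : I) : P v := by
  obtain ⟨k, hk⟩ := T.reaches v
  induction k generalizing v with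
  | zero => exact (show v = T.root from hk) ▸ root
  | succ k ih =>
    by_cases h : v = T.root
    · exact h ▸ root
    · exact step v h (ih _ hk)

theorem height_root [DecidableEq I] (T : LabelledRootedTree I) : T.height T.root = 0 :=
  (Nat.find_eq_zero _).2 rfl

theorem height_of_ne_root [DecidableEq I] (T : LabelledRootedTree I) {v : I} (h : v ≠ T.root) :
    T.height v = T.height (T.parent v) + 1 :=
  Nat.find_comp_succ (T.reaches v) (T.reaches (T.parent v)) h

instance [Finite I] : Finite (LabelledRootedTree I) :=
  Finite.of_injective _ parent_injective

instance [Finite I] : Fintype (LabelledRootedTree I) :=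
  Fintype.ofFinite _

theorem relabel_parent_apply (e : I ≃ J) (T : LabelledRootedTree I) (x : I) :
    (T.relabel e).parent (e x) = e (T.parent x) := by
  simp [relabel]

/-- Relabelling along a bijection is a bijection on trees. -/
@[simps apply]
def relabelEquiv (e : I ≃ J) : LabelledRootedTree I ≃ LabelledRootedTree J where
  toFun := relabel e
  invFun := relabel e.symm
  left_inv T := parent_injective (by funext x; simp [relabel])
  right_inv T := parent_injective (by funext x; simp [relabel])

theorem relabel_symm_relabel (e : I ≃ J) (T : LabelledRootedTree I) :
    (T.relabel e).relabel e.symm = T :=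
  (relabelEquiv e).left_inv T

theorem relabel_relabel_symm (e : I ≃ J) (T : LabelledRootedTree J) :
    (T.relabel e.symm).relabel e = T :=
  (relabelEquiv e).right_inv T

theorem height_relabel [DecidableEq I] [DecidableEq J] (e : I ≃ J) (T : LabelledRootedTree I)
    (x : I) : (T.relabel e).height (e x) = T.height x := by
  induction x using T.parent_induction with
  | root => rw [T.height_root]; exact height_root _
  | step x hx ih =>
    rw [T.height_of_ne_root hx, height_of_ne_root _ (fun h => hx (e.injective h)),
      relabel_parent_apply, ih]

theorem energy_relabel [Fintype I] [DecidableEq I] [Fintype J] [DecidableEq J] (e : I ≃ J)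
    (T : LabelledRootedTree I) (w : J → ℕ+) :
    (T.relabel e).energy w = T.energy (w ∘ e) := by
  simp only [energy, Function.comp_apply]
  rw [← e.sum_comp]
  simp only [height_relabel]

theorem energy_of_subsingleton [Fintype I] [DecidableEq I] [Subsingleton I]
    (T : LabelledRootedTree I) (w : I → ℕ+) : T.energy w = 0 :=
  Finset.sum_eq_zero fun x _ => by rw [Subsingleton.elim x T.root, T.height_root, mul_zero]

instance [Subsingleton I] : Subsingleton (LabelledRootedTree I) :=
  ⟨fun _ _ => parent_injective (Subsingleton.elim _ _)⟩

end LabelledRootedTree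

/-! ## Collapsing a block of labels -/

section Collapse

variable {I J L L' : Type} {v : I}

/-- The map contracting the block `J` of labels to the label `v`. -/
def collapse (ρ : {x : I // x ≠ v} ⊕ J ≃ L) (k : L) : I :=
  Sum.elim Subtype.val (fun _ => v) (ρ.symm k)

/-- The section of `collapse` sending `v` to the label `r` of the block. -/
def liftLabel [DecidableEq I] (ρ : {x : I // x ≠ v} ⊕ J ≃ L) (r : J) (x : I) : L :=
  if h : x = v then ρ (Sum.inr r) else ρ (Sum.inl ⟨x, h⟩)

variable (ρ : {x : I // x ≠ v} ⊕ J ≃ L)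

@[simp] theorem collapse_inl (x : {x : I // x ≠ v}) : collapse ρ (ρ (Sum.inl x)) = x.1 := by
  simp [collapse]

@[simp] theorem collapse_inr (y : J) : collapse ρ (ρ (Sum.inr y)) = v := by
  simp [collapse]

theorem collapse_trans (e : L ≃ L') (k : L') :
    collapse (ρ.trans e) k = collapse ρ (e.symm k) := rfl

variable {ρ}

theorem exists_inr_of_collapse_eq {k : L} (h : collapse ρ k = v) : ∃ y, ρ (Sum.inr y) = k := by
  obtain ⟨z, rfl⟩ := ρ.surjective k
  rcases z with x | y
  · exact absurd (by simpa using h) x.2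
  · exact ⟨y, rfl⟩

/-- Contraction is injective away from the block, so labels outside the block may be compared after
contracting. -/
theorem eq_of_collapse_eq {k k' : L} (h : collapse ρ k = collapse ρ k')
    (h' : collapse ρ k' ≠ v) : k = k' := by
  obtain ⟨z, rfl⟩ := ρ.surjective k
  obtain ⟨z', rfl⟩ := ρ.surjective k'
  rcases z with x | y <;> rcases z' with x' | y'
  · simp only [collapse_inl] at h
    rw [Subtype.ext h]
  · simp at h'
  · rw [← h] at h'; simp at h'
  · simp at h'

theorem inr_injective {y y' : J} (h : ρ (Sum.inr y) = ρ (Sum.inr y')) : y = y' :=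
  Sum.inr_injective (ρ.injective h)

variable [DecidableEq I]

variable (ρ) in
@[simp] theorem liftLabel_self (r : J) : liftLabel ρ r v = ρ (Sum.inr r) := by simp [liftLabel]

variable (ρ) in
theorem liftLabel_of_ne (r : J) {x : I} (h : x ≠ v) :
    liftLabel ρ r x = ρ (Sum.inl ⟨x, h⟩) := by simp [liftLabel, h]

variable (ρ) in
@[simp] theorem collapse_liftLabel (r : J) (x : I) : collapse ρ (liftLabel ρ r x) = x := by
  by_cases h : x = v
  · subst h; simp
  · simp [liftLabel_of_ne ρ r h]

theorem liftLabel_ne_inr {r y : J} (h : y ≠ r) (x : I) : liftLabel ρ r x ≠ ρ (Sum.inr y) := by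
  intro hx
  have : x = v := by rw [← collapse_liftLabel ρ r x, hx, collapse_inr]
  subst this
  rw [liftLabel_self] at hx
  exact h (inr_injective hx).symm

variable (ρ) in
-- Basic case distinction: the lifts of the labels of `I`, with `r` standing for the whole block,
-- together with the other block labels exhaust `L`. With `r` the root of `T`, lifts are the
-- vertices whose outgoing edge comes from `S`, and the others have an edge coming from `T`.
theorem eq_liftLabel_or (r : J) (k : L) :
    k = liftLabel ρ r (collapse ρ k) ∨ ∃ y, y ≠ r ∧ k = ρ (Sum.inr y) := by
  obtain ⟨z, rfl⟩ := ρ.surjective k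
  rcases z with x | y
  · left; simp [liftLabel_of_ne ρ r x.2]
  · by_cases h : y = r
    · left; simp [h]
    · exact Or.inr ⟨y, h, rfl⟩

theorem eq_liftLabel {r : J} {k : L} (h : ∀ y, y ≠ r → k ≠ ρ (Sum.inr y)) :
    k = liftLabel ρ r (collapse ρ k) := by
  rcases eq_liftLabel_or ρ r k with h' | ⟨y, hy, h'⟩
  · exact h'
  · exact absurd h' (h y hy)

/-! ### Weights -/

variable [Fintype J]

/-- The weights obtained when a block of labels is contracted. -/
def collapseWeight (ρ : {x : I // x ≠ v} ⊕ J ≃ L) (c : L → ℕ+) (x : I) : ℕ+ :=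
  if h : x = v then (∑ y, (c (ρ (Sum.inr y)) : ℕ)).toPNat' else c (ρ (Sum.inl ⟨x, h⟩))

/-- The weights of the labels of a block. -/
def blockWeight (ρ : {x : I // x ≠ v} ⊕ J ≃ L) (c : L → ℕ+) (y : J) : ℕ+ := c (ρ (Sum.inr y))

variable (ρ) in
theorem collapseWeight_inl (c : L → ℕ+) (x : {x : I // x ≠ v}) :
    collapseWeight ρ c x = c (ρ (Sum.inl x)) := by
  simp [collapseWeight, x.2]

variable (ρ) in
-- A nonempty block has positive total weight; for an empty one `Nat.toPNat'` would replace `0` by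
-- `1`.
theorem collapseWeight_self [Nonempty J] (c : L → ℕ+) :
    (collapseWeight ρ c v : ℕ) = ∑ y, (blockWeight ρ c y : ℕ) := by
  have h : 0 < ∑ y, (c (ρ (Sum.inr y)) : ℕ) :=
    Finset.sum_pos (fun y _ => (c _).pos) Finset.univ_nonempty
  simp [collapseWeight, blockWeight, Nat.toPNat'_coe, h]

variable (ρ) in
-- Weights of a contraction are sums over the fibres of `collapse`. This form does not single out
-- `v`, so iterated contractions are compared through their collapse maps only.
theorem collapseWeight_eq_sum [Fintype I] [Fintype L] [Nonempty J] (c : L → ℕ+) (x : I) :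
    (collapseWeight ρ c x : ℕ) = ∑ k, if collapse ρ k = x then (c k : ℕ) else 0 := by
  rw [← ρ.sum_comp, Fintype.sum_sum_type]
  simp only [collapse_inl, collapse_inr]
  by_cases h : x = v
  · subst h
    have hz : ∀ z : {y : I // y ≠ x}, ((z : I) = x) = False := fun z => eq_false z.2
    simp [collapseWeight_self, blockWeight, hz]
  · rw [Finset.sum_eq_single (⟨x, h⟩ : {x : I // x ≠ v})]
    · simp [collapseWeight, h, Ne.symm h]
    · rintro b - hb
      exact if_neg fun hx => hb (Subtype.ext hx)
    · simp

end Collapse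

namespace LabelledRootedTree

variable {I J L : Type} {v : I} [DecidableEq I]

/-! ## The trees obtained by substitution -/

/-- The tree `U` is obtained by substituting `T` for the vertex `v` of `S`, for some
reattachment of the incoming edges: the block of labels `J` spans the subtree `T`, and
contracting this subtree yields `S`. -/
structure IsSubst (ρ : {x : I // x ≠ v} ⊕ J ≃ L) (U : LabelledRootedTree L)
    (S : LabelledRootedTree I) (T : LabelledRootedTree J) : Prop where
  parent_inr : ∀ y, y ≠ T.root → U.parent (ρ (Sum.inr y)) = ρ (Sum.inr (T.parent y))
  collapse_parent : ∀ x, collapse ρ (U.parent (liftLabel ρ T.root x)) = S.parent x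

variable {ρ : {x : I // x ≠ v} ⊕ J ≃ L} {U U' : LabelledRootedTree L}
  {S S' : LabelledRootedTree I} {T T' : LabelledRootedTree J}

theorem isSubst_subst [DecidableEq J] (f : S.Incoming v → J) :
    IsSubst ρ ((S.subst v T f).relabel ρ) S T := by
  constructor
  · intro y hy
    rw [relabel_parent_apply]
    simp [subst, substParent, hy]
  · intro x
    by_cases hx : x = v
    · subst hx
      rw [liftLabel_self, relabel_parent_apply]
      by_cases h : S.parent x = x <;> simp [subst, substParent, h]
    · rw [liftLabel_of_ne _ _ hx, relabel_parent_apply]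
      by_cases hr : x = S.root
      · simp [subst, substParent, hr, S.parent_root]
      · by_cases h : S.parent x = v <;> simp [subst, substParent, hr, h]

theorem subst_injective [DecidableEq J] :
    Function.Injective fun f : S.Incoming v → J => (S.subst v T f).relabel ρ := by
  intro f g h
  funext ⟨x, hr, hx⟩
  have hxv : x ≠ v := by
    rintro rfl
    exact hr (S.parent_eq_self_iff.1 hx)
  have h' := congrArg (fun U => U.parent (ρ (Sum.inl ⟨x, hxv⟩))) h
  simp only [relabel_parent_apply] at h'
  have h'' := ρ.injective h'
  simpa [subst, substParent, hr, hx] using h''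

/-- A map of labels that has the shape of the parent map of a substitution is one. -/
theorem exists_subst_parent_eq [DecidableEq J] {p : L → L}
    (hT : ∀ y, y ≠ T.root → p (ρ (Sum.inr y)) = ρ (Sum.inr (T.parent y)))
    (hS : ∀ x, collapse ρ (p (liftLabel ρ T.root x)) = S.parent x)
    (hr : p (liftLabel ρ T.root S.root) = liftLabel ρ T.root S.root) :
    ∃ f, ((S.subst v T f).relabel ρ).parent = p := by
  -- The edge `e` ends at `v` after contraction, so `p` sends its source into the block; the block
  -- label reached is the value of `f` at `e`.
  have hf : ∀ e : S.Incoming v, ∃ y, ρ (Sum.inr y) = p (liftLabel ρ T.root e.1) := fun e =>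
    exists_inr_of_collapse_eq ((hS e.1).trans e.2.2)
  choose f hf using hf
  refine ⟨f, funext fun k => ?_⟩
  obtain ⟨z, rfl⟩ := ρ.surjective k
  rw [relabel_parent_apply]
  rcases z with ⟨x, hx⟩ | y
  · by_cases hxr : x = S.root
    · subst hxr
      rw [liftLabel_of_ne _ _ hx] at hr
      simp [subst, substParent, hr]
    · by_cases h : S.parent x = v
      · have := hf ⟨x, hxr, h⟩
        rw [liftLabel_of_ne _ _ hx] at this
        simp [subst, substParent, hxr, h, this]
      · have h1 := hS x
        rw [liftLabel_of_ne _ _ hx] at h1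
        simp only [subst, substParent, hxr, h, dite_false]
        refine eq_of_collapse_eq (ρ := ρ) ?_ ?_
        · simp [h1]
        · rwa [h1]
  · by_cases hy : y = T.root
    · subst hy
      by_cases h : S.parent v = v
      · have hv := S.parent_eq_self_iff.1 h
        rw [← hv, liftLabel_self] at hr
        simp [subst, substParent, h, hr]
      · have h1 := hS v
        rw [liftLabel_self] at h1
        simp only [subst, substParent, h, dite_false, if_true]
        refine eq_of_collapse_eq (ρ := ρ) ?_ ?_
        · simp [h1]
        · rwa [h1]
    · simp [subst, substParent, hy, hT y hy]

namespace IsSubst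

/-- A block label other than the root of `T` cannot be fixed by the parent map of `U`, since it
would then be fixed by that of `T`. So the root of `U` is a lift, and its contraction is fixed in
`S`. -/
theorem root_eq (h : IsSubst ρ U S T) : U.root = liftLabel ρ T.root S.root := by
  rcases eq_liftLabel_or ρ T.root U.root with hU | ⟨y, hy, hU⟩
  · have := h.collapse_parent (collapse ρ U.root)
    rw [← hU, U.parent_root] at this
    rwa [S.parent_eq_self_iff.1 this.symm] at hU
  · have := h.parent_inr y hy
    rw [← hU, U.parent_root, hU] at this
    exact absurd (T.parent_eq_self_iff.1 (inr_injective this).symm) hy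

theorem parent_liftLabel_root (h : IsSubst ρ U S T) :
    U.parent (liftLabel ρ T.root S.root) = liftLabel ρ T.root S.root := by
  rw [← h.root_eq, U.parent_root]

theorem parent_collapse (h : IsSubst ρ U S T) {k : L}
    (hk : ∀ y, y ≠ T.root → k ≠ ρ (Sum.inr y)) :
    S.parent (collapse ρ k) = collapse ρ (U.parent k) := by
  rw [← h.collapse_parent, ← eq_liftLabel hk]

theorem exists_subst [DecidableEq J] (h : IsSubst ρ U S T) :
    ∃ f, (S.subst v T f).relabel ρ = U := by
  obtain ⟨f, hf⟩ := exists_subst_parent_eq h.parent_inr h.collapse_parent h.parent_liftLabel_root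
  exact ⟨f, parent_injective hf⟩

theorem liftLabel_ne_root (h : IsSubst ρ U S T) {x : I} (hx : x ≠ S.root) :
    liftLabel ρ T.root x ≠ U.root := by
  rw [h.root_eq]
  intro hc
  exact hx (by simpa using congrArg (collapse ρ) hc)

theorem outer_unique (h : IsSubst ρ U S T) (h' : IsSubst ρ U S' T) : S = S' :=
  parent_injective (funext fun x => by rw [← h.collapse_parent, ← h'.collapse_parent])

/-- The point is that the roots agree. If they differed, every block vertex would have its parent in
the block, so the root of `U` would lie in the block; but a block vertex that is the root of `U` has
to be the root of both subtrees. -/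
theorem inner_unique (h : IsSubst ρ U S T) (h' : IsSubst ρ U S' T') : T = T' := by
  have hr : T.root = T'.root := by
    by_contra hne
    have hp := h.parent_inr T'.root (Ne.symm hne)
    have hp' := h'.parent_inr T.root hne
    have hclosed : ∀ y, ∃ y', U.parent (ρ (Sum.inr y)) = ρ (Sum.inr y') := fun y => by
      by_cases hy : y = T.root
      · exact ⟨_, hy ▸ hp'⟩
      · exact ⟨_, h.parent_inr y hy⟩
    have hmem : ∀ k : L, (∃ y, k = ρ (Sum.inr y)) → ∃ y, U.root = ρ (Sum.inr y) := by
      intro k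
      induction k using U.parent_induction with
      | root => exact id
      | step k hk ih =>
        rintro ⟨y, rfl⟩
        exact ih (hclosed y)
    obtain ⟨y, hy⟩ := hmem _ ⟨T.root, rfl⟩
    have h1 : y = T.root := by
      by_contra hy1
      exact liftLabel_ne_inr hy1 _ (h.root_eq.symm.trans hy)
    have h2 : y = T'.root := by
      by_contra hy1
      exact liftLabel_ne_inr hy1 _ (h'.root_eq.symm.trans hy)
    exact hne (h1.symm.trans h2)
  refine parent_injective (funext fun y => ?_)
  by_cases hy : y = T.root
  · rw [hy, T.parent_root, hr, T'.parent_root]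
  · exact inr_injective (ρ := ρ) (by rw [← h.parent_inr y hy, ← h'.parent_inr y (hr ▸ hy)])

end IsSubst

/-- If a block of labels spans a subtree, this subtree can be contracted. -/
theorem exists_isSubst (h : ∀ y, y ≠ T.root → U.parent (ρ (Sum.inr y)) = ρ (Sum.inr (T.parent y))) :
    ∃ S, IsSubst ρ U S T := by
  set p : I → I := fun x => collapse ρ (U.parent (liftLabel ρ T.root x)) with hp
  have hroot : p (collapse ρ U.root) = collapse ρ U.root := by
    rcases eq_liftLabel_or ρ T.root U.root with hU | ⟨y, hy, hU⟩
    · rw [hp]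
      simp only
      rw [← hU, U.parent_root]
    · have := h y hy
      rw [← hU, U.parent_root, hU] at this
      exact absurd (T.parent_eq_self_iff.1 (inr_injective this).symm) hy
  -- Follow the path to the root in `U`: an edge leaving a lifted label becomes one step of `p`, and
  -- an edge leaving another block label is contracted and becomes none.
  have hreach : ∀ k : L, ∃ n : ℕ, p^[n] (collapse ρ k) = collapse ρ U.root := by
    intro k
    induction k using U.parent_induction with
    | root => exact ⟨0, rfl⟩
    | step k hk ih =>
      obtain ⟨n, hn⟩ := ih
      rcases eq_liftLabel_or ρ T.root k with hU | ⟨y, hy, rfl⟩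
      · refine ⟨n + 1, ?_⟩
        rw [Function.iterate_succ_apply, ← hn]
        simp only [hp]
        rw [← hU]
      · rw [h y hy, collapse_inr] at hn
        exact ⟨n, by rw [collapse_inr, hn]⟩
  exact ⟨⟨collapse ρ U.root, p, hroot, fun x => by
    simpa using hreach (liftLabel ρ T.root x)⟩, h, fun _ => rfl⟩

/-! ### Heights and potential energy -/

variable [DecidableEq J] [DecidableEq L]

namespace IsSubst

theorem height_inr (h : IsSubst ρ U S T) (y : J) :
    U.height (ρ (Sum.inr y)) = U.height (ρ (Sum.inr T.root)) + T.height y := by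
  induction y using T.parent_induction with
  | root => rw [T.height_root, add_zero]
  | step y hy ih =>
    have hU : ρ (Sum.inr y) ≠ U.root := by
      rw [h.root_eq]
      exact (liftLabel_ne_inr hy _).symm
    rw [U.height_of_ne_root hU, h.parent_inr y hy, ih, T.height_of_ne_root hy, add_assoc]

/-- Contraction never lengthens a path: an edge of `S` into `v` that lands in `U` on the block
vertex `y` costs `T.height y` extra steps to get to the root of the block. -/
theorem height_le (h : IsSubst ρ U S T) (x : I) :
    S.height x ≤ U.height (liftLabel ρ T.root x) := by
  induction x using S.parent_induction with
  | root => rw [S.height_root]; exact Nat.zero_le _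
  | step x hx ih =>
    rw [S.height_of_ne_root hx, U.height_of_ne_root (h.liftLabel_ne_root hx),
      ← h.collapse_parent x]
    rw [← h.collapse_parent x] at ih
    refine Nat.succ_le_succ (ih.trans ?_)
    rcases eq_liftLabel_or ρ T.root (U.parent (liftLabel ρ T.root x)) with hk | ⟨y, hy, hk⟩
    · rw [← hk]
    · rw [hk, collapse_inr, liftLabel_self, h.height_inr y]
      exact Nat.le_add_right _ _

/-- The height of a block vertex is that of the block's root plus its height in `T`. The first part,
summed with weights, is the contribution of `v` carrying the weight of the whole block; the second
sums to the energy of `T`. -/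
theorem energy_eq [Fintype I] [Fintype J] [Fintype L] (h : IsSubst ρ U S T) (c : L → ℕ+) :
    U.energy c = (∑ x, (collapseWeight ρ c x : ℕ) * U.height (liftLabel ρ T.root x)) +
      T.energy (blockWeight ρ c) := by
  have : Nonempty J := ⟨T.root⟩
  have hsum : ∀ F : I → ℕ, ∑ x, F x = ∑ x : {x : I // x ≠ v}, F x + F v := by
    intro F
    rw [← Fintype.sum_subtype_add_sum_subtype (fun x => x ≠ v)]
    congr 1
    rw [Fintype.sum_eq_single (⟨v, by simp⟩ : {x // ¬ x ≠ v})]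
    rintro ⟨x, hx⟩ hne
    exact absurd (Subtype.ext (not_not.1 hx)) hne
  rw [hsum, energy, ← ρ.sum_comp, Fintype.sum_sum_type, add_assoc]
  congr 1
  · refine Finset.sum_congr rfl fun x _ => ?_
    rw [collapseWeight_inl, liftLabel_of_ne _ _ x.2]
  · rw [collapseWeight_self, liftLabel_self, energy, Finset.sum_mul, ← Finset.sum_add_distrib]
    refine Finset.sum_congr rfl fun y _ => ?_
    rw [h.height_inr, mul_add]
    rfl

theorem energy_add_le [Fintype I] [Fintype J] [Fintype L] (h : IsSubst ρ U S T) (c : L → ℕ+) :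
    S.energy (collapseWeight ρ c) + T.energy (blockWeight ρ c) ≤ U.energy c := by
  rw [h.energy_eq]
  exact Nat.add_le_add_right
    (Finset.sum_le_sum fun x _ => Nat.mul_le_mul_left _ (h.height_le x)) _

end IsSubst

variable (ρ S T) in
-- With all edges attached to the root of `T`, paths from lifted labels use no edge of `T`, so
-- `IsSubst.height_le` becomes an equality.
theorem height_subst_toRoot (x : I) :
    ((S.subst v T (S.toRoot v T)).relabel ρ).height (liftLabel ρ T.root x) = S.height x := by
  have h : IsSubst ρ ((S.subst v T (S.toRoot v T)).relabel ρ) S T := isSubst_subst _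
  induction x using S.parent_induction with
  | root => rw [← h.root_eq, height_root, height_root]
  | step x hx ih =>
    rw [S.height_of_ne_root hx, height_of_ne_root _ (h.liftLabel_ne_root hx), ← ih]
    congr 2
    by_cases hp : S.parent x = v
    · have hxv : x ≠ v := by
        rintro rfl
        exact hx (S.parent_eq_self_iff.1 hp)
      rw [liftLabel_of_ne _ _ hxv, relabel_parent_apply, hp, liftLabel_self]
      simp [subst, substParent, hx, hp, toRoot]
    · refine eq_of_collapse_eq (ρ := ρ) ?_ ?_
      · rw [h.collapse_parent, collapse_liftLabel]
      · rwa [collapse_liftLabel]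

theorem IsSubst.height_subst_toRoot_le (h : IsSubst ρ U S T) (k : L) :
    ((S.subst v T (S.toRoot v T)).relabel ρ).height k ≤ U.height k := by
  have h₀ : IsSubst ρ ((S.subst v T (S.toRoot v T)).relabel ρ) S T := isSubst_subst _
  have key : ∀ x, ((S.subst v T (S.toRoot v T)).relabel ρ).height (liftLabel ρ T.root x) ≤
      U.height (liftLabel ρ T.root x) := fun x => by
    rw [height_subst_toRoot]
    exact h.height_le x
  rcases eq_liftLabel_or ρ T.root k with hk | ⟨y, hy, rfl⟩
  · rw [hk]
    exact key _
  · rw [h.height_inr, h₀.height_inr]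
    simpa using key v

variable [Fintype L]

theorem energy_subst_toRoot [Fintype I] [Fintype J] (c : L → ℕ+) :
    ((S.subst v T (S.toRoot v T)).relabel ρ).energy c =
      S.energy (collapseWeight ρ c) + T.energy (blockWeight ρ c) := by
  rw [(isSubst_subst (S.toRoot v T)).energy_eq]
  simp only [height_subst_toRoot]
  rfl

theorem IsSubst.energy_subst_toRoot_le (h : IsSubst ρ U S T) (c : L → ℕ+) :
    ((S.subst v T (S.toRoot v T)).relabel ρ).energy c ≤ U.energy c :=
  Finset.sum_le_sum fun k _ => Nat.mul_le_mul_left _ (h.height_subst_toRoot_le k)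

/-- An edge attached away from the root of `T` strictly raises its source, whose weight is positive,
and no other vertex gets lower. -/
theorem energy_subst_toRoot_lt (c : L → ℕ+) {f : S.Incoming v → J} (hf : f ≠ S.toRoot v T) :
    ((S.subst v T (S.toRoot v T)).relabel ρ).energy c <
      ((S.subst v T f).relabel ρ).energy c := by
  have h : IsSubst ρ ((S.subst v T f).relabel ρ) S T := isSubst_subst _
  obtain ⟨⟨x, hr, hx⟩, hfx⟩ := Function.ne_iff.1 hf
  have hfx : f ⟨x, hr, hx⟩ ≠ T.root := hfx
  have hxv : x ≠ v := by
    rintro rfl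
    exact hr (S.parent_eq_self_iff.1 hx)
  refine Finset.sum_lt_sum (fun k _ => Nat.mul_le_mul_left _ (h.height_subst_toRoot_le k))
    ⟨liftLabel ρ T.root x, Finset.mem_univ _, Nat.mul_lt_mul_of_pos_left ?_ (c _).pos⟩
  have hp : ((S.subst v T f).relabel ρ).parent (liftLabel ρ T.root x) =
      ρ (Sum.inr (f ⟨x, hr, hx⟩)) := by
    rw [liftLabel_of_ne _ _ hxv, relabel_parent_apply]
    simp [subst, substParent, hr, hx]
  have hv := h.height_le v
  rw [liftLabel_self] at hv
  have hxh := S.height_of_ne_root hr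
  rw [hx] at hxh
  rw [height_subst_toRoot, hxh, height_of_ne_root _ (h.liftLabel_ne_root hr), hp, h.height_inr,
    T.height_of_ne_root hfx]
  omega

end LabelledRootedTree

/-! ## The weights of iterated contractions -/

section Weights

variable {I J L N M Q : Type} [DecidableEq I] [Fintype J] {v : I}

theorem collapseWeight_collapse {ρ : {x : I // x ≠ v} ⊕ J ≃ L} (c : L → ℕ+) {k : L}
    (hk : collapse ρ k ≠ v) : collapseWeight ρ c (collapse ρ k) = c k := by
  obtain ⟨z, rfl⟩ := ρ.surjective k
  rcases z with x | y
  · rw [collapse_inl, collapseWeight_inl]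
  · simp at hk

variable [Fintype L] [Fintype I]

theorem sum_ite_collapseWeight [Nonempty J] (ρ : {x : I // x ≠ v} ⊕ J ≃ L) (c : L → ℕ+)
    (P : I → Prop) [DecidablePred P] :
    ∑ x, (if P x then (collapseWeight ρ c x : ℕ) else 0) =
      ∑ k, if P (collapse ρ k) then (c k : ℕ) else 0 := by
  have h : ∀ x, (if P x then (collapseWeight ρ c x : ℕ) else 0) =
      ∑ k, if collapse ρ k = x then (if P (collapse ρ k) then (c k : ℕ) else 0) else 0 := by
    intro x
    split_ifs with hx
    · rw [collapseWeight_eq_sum]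
      refine Finset.sum_congr rfl fun k _ => ?_
      split_ifs with h1 h2
      · rfl
      · exact absurd (h1 ▸ hx) h2
      · rfl
    · refine (Finset.sum_eq_zero fun k _ => ?_).symm
      split_ifs with h1 h2
      · exact absurd (h1 ▸ h2) hx
      · rfl
      · rfl
  simp only [h]
  rw [Finset.sum_comm]
  simp

variable [DecidableEq N] [Fintype N] [Fintype M] {w : N}

theorem collapseWeight_collapseWeight [Nonempty Q] [Nonempty J] [Nonempty M] [Fintype Q]
    {ρ₁ : {x : N // x ≠ w} ⊕ Q ≃ L} {ρ₂ : {x : I // x ≠ v} ⊕ J ≃ N} {v' : I}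
    {ρ₃ : {x : I // x ≠ v'} ⊕ M ≃ L} (h : ∀ k, collapse ρ₂ (collapse ρ₁ k) = collapse ρ₃ k)
    (c : L → ℕ+) : collapseWeight ρ₂ (collapseWeight ρ₁ c) = collapseWeight ρ₃ c := by
  funext x
  apply PNat.eq
  rw [collapseWeight_eq_sum, sum_ite_collapseWeight, collapseWeight_eq_sum]
  simp only [h]

end Weights

/-! ## The composition in terms of coefficients -/

variable {K : Type u} [Field K]

section Graft

variable {I J L : Type} {v : I} [DecidableEq I] [DecidableEq J] [DecidableEq L]
  [Fintype I] [Fintype J] [Fintype L]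

open Classical in
/-- The coefficient at the tree `U` of weights `c` of the composition of two families of
linear combinations of trees, given by their coefficients. -/
def graft (lam : K) (ρ : {x : I // x ≠ v} ⊕ J ≃ L)
    (x : (I → ℕ+) → LabelledRootedTree I → K) (y : (J → ℕ+) → LabelledRootedTree J → K)
    (c : L → ℕ+) (U : LabelledRootedTree L) : K :=
  ∑ S, ∑ T, if IsSubst ρ U S T then
    lam ^ (U.energy c - (S.energy (collapseWeight ρ c) + T.energy (blockWeight ρ c))) *
      (x (collapseWeight ρ c) S * y (blockWeight ρ c) T) else 0

variable {lam : K} {ρ : {x : I // x ≠ v} ⊕ J ≃ L} {x : (I → ℕ+) → LabelledRootedTree I → K}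
  {y : (J → ℕ+) → LabelledRootedTree J → K} {c : L → ℕ+} {U : LabelledRootedTree L}
  {S : LabelledRootedTree I} {T : LabelledRootedTree J}

/-- Since `S` and `T` are determined by `U`, only one term of the double sum survives. -/
theorem graft_eq (h : IsSubst ρ U S T) : graft lam ρ x y c U =
    lam ^ (U.energy c - (S.energy (collapseWeight ρ c) + T.energy (blockWeight ρ c))) *
      (x (collapseWeight ρ c) S * y (blockWeight ρ c) T) := by
  rw [graft, Finset.sum_eq_single S, Finset.sum_eq_single T, if_pos h]
  · intro T' _ hT
    exact if_neg fun h' => hT (h'.inner_unique h)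
  · simp
  · intro S' _ hS
    refine Finset.sum_eq_zero fun T' _ => if_neg fun h' => hS ?_
    obtain rfl := h'.inner_unique h
    exact h'.outer_unique h
  · simp

theorem graft_eq_zero (h : ∀ S T, IsSubst ρ U S T →
    x (collapseWeight ρ c) S * y (blockWeight ρ c) T = 0) : graft lam ρ x y c U = 0 := by
  refine Finset.sum_eq_zero fun S _ => Finset.sum_eq_zero fun T _ => ?_
  split_ifs with hU
  · rw [h S T hU, mul_zero]
  · rfl

/-! ### Equivariance -/

variable {I' J' L' : Type} {v' : I'} [DecidableEq I'] [DecidableEq J'] [DecidableEq L']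
  [Fintype I'] [Fintype J'] [Fintype L'] {ρ' : {x : I' // x ≠ v'} ⊕ J' ≃ L'}

omit [DecidableEq J] [DecidableEq L] [Fintype I] [Fintype J] [Fintype L]
  [DecidableEq J'] [DecidableEq L'] [Fintype I'] [Fintype J'] [Fintype L'] in
theorem isSubst_relabel_iff {e : L ≃ L'} {σ : I ≃ I'} {τ : J ≃ J'}
    (hσ : ∀ k, collapse ρ' (e k) = σ (collapse ρ k))
    (hτ : ∀ y, e (ρ (Sum.inr y)) = ρ' (Sum.inr (τ y))) :
    IsSubst ρ' (U.relabel e) (S.relabel σ) (T.relabel τ) ↔ IsSubst ρ U S T := by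
  have hlift : ∀ r x, liftLabel ρ' (τ r) (σ x) = e (liftLabel ρ r x) := by
    intro r x
    have hk : ∀ y', y' ≠ τ r → e (liftLabel ρ r x) ≠ ρ' (Sum.inr y') := by
      intro y' hy' h
      obtain ⟨y, rfl⟩ := τ.surjective y'
      rw [← hτ] at h
      exact liftLabel_ne_inr (fun hy => hy' (congrArg τ hy)) x (e.injective h)
    rw [eq_liftLabel hk, hσ, collapse_liftLabel]
  constructor
  · intro h
    refine ⟨fun y hy => e.injective ?_, fun x => σ.injective ?_⟩
    · rw [← relabel_parent_apply, hτ, hτ, h.parent_inr (τ y) (fun hc => hy (τ.injective hc)),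
        relabel_parent_apply]
    · have := h.collapse_parent (σ x)
      rwa [relabel_parent_apply, show (T.relabel τ).root = τ T.root from rfl, hlift,
        relabel_parent_apply, hσ] at this
  · intro h
    refine ⟨fun y' hy => ?_, fun x' => ?_⟩
    · obtain ⟨y, rfl⟩ := τ.surjective y'
      rw [← hτ, relabel_parent_apply, h.parent_inr y (fun hc => hy (congrArg τ hc)), hτ,
        relabel_parent_apply]
    · obtain ⟨x, rfl⟩ := σ.surjective x'
      rw [show (T.relabel τ).root = τ T.root from rfl, hlift, relabel_parent_apply, hσ,
        h.collapse_parent, relabel_parent_apply]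

/-- Compatible bijections of the three label sets preserve `IsSubst`, fibre sums of weights and
energies; equivariance is the special case of permutations. -/
theorem graft_relabel {x' : (I' → ℕ+) → LabelledRootedTree I' → K}
    {y' : (J' → ℕ+) → LabelledRootedTree J' → K} {e : L ≃ L'} {σ : I ≃ I'} {τ : J ≃ J'}
    (hσ : ∀ k, collapse ρ' (e k) = σ (collapse ρ k))
    (hτ : ∀ y, e (ρ (Sum.inr y)) = ρ' (Sum.inr (τ y)))
    (hx : ∀ a S, x a S = x' (a ∘ σ.symm) (S.relabel σ))
    (hy : ∀ b T, y b T = y' (b ∘ τ.symm) (T.relabel τ)) :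
    graft lam ρ x y c U = graft lam ρ' x' y' (c ∘ e.symm) (U.relabel e) := by
  by_cases h : ∃ S T, IsSubst ρ U S T
  · obtain ⟨S, T, h⟩ := h
    have : Nonempty J := ⟨T.root⟩
    have : Nonempty J' := ⟨τ T.root⟩
    have hb : blockWeight ρ' (c ∘ e.symm) = blockWeight ρ c ∘ τ.symm := by
      funext y
      obtain ⟨y, rfl⟩ := τ.surjective y
      simp [blockWeight, ← hτ]
    have hc : collapseWeight ρ' (c ∘ e.symm) = collapseWeight ρ c ∘ σ.symm := by
      funext x
      obtain ⟨x, rfl⟩ := σ.surjective x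
      apply PNat.eq
      simp only [Function.comp_apply, Equiv.symm_apply_apply]
      rw [collapseWeight_eq_sum, collapseWeight_eq_sum, ← e.sum_comp]
      simp [hσ]
    rw [graft_eq h, graft_eq ((isSubst_relabel_iff hσ hτ).2 h), hx, hy, hb, hc]
    simp only [energy_relabel, Function.comp_assoc, Equiv.symm_comp_self, Function.comp_id]
  · rw [graft_eq_zero fun S T hU => absurd ⟨S, T, hU⟩ h]
    refine (graft_eq_zero fun S T hU => absurd ⟨S.relabel σ.symm, T.relabel τ.symm, ?_⟩ h).symm
    rwa [← isSubst_relabel_iff hσ hτ, relabel_relabel_symm, relabel_relabel_symm]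

/-! ### Units -/

/-- Here the block is all of `T`; its contraction is the one-vertex tree, of energy `0`, so the
exponent vanishes. -/
theorem graft_unit_left [Subsingleton I] {ρ : {x : I // x ≠ v} ⊕ J ≃ J}
    (hρ : ∀ y, ρ (Sum.inr y) = y) (hx : ∀ a S, x a S = 1) (b : J → ℕ+)
    (T : LabelledRootedTree J) (S : LabelledRootedTree I) : graft lam ρ x y b T = y b T := by
  have h : IsSubst ρ T S T :=
    ⟨fun y _ => by rw [hρ, hρ], fun _ => Subsingleton.elim _ _⟩
  have hb : blockWeight ρ b = b := by
    funext y
    rw [blockWeight, hρ]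
  rw [graft_eq h, hx, hb, energy_of_subsingleton S]
  simp

theorem graft_unit_right [Unique J] {ρ : {x : I // x ≠ v} ⊕ J ≃ I}
    (hρ : ∀ k, collapse ρ k = k) (hy : ∀ b T, y b T = 1) (a : I → ℕ+)
    (S : LabelledRootedTree I) (T : LabelledRootedTree J) : graft lam ρ x y a S = x a S := by
  have hl : ∀ r k, liftLabel ρ r k = k := fun r k => by
    rw [← hρ (liftLabel ρ r k), collapse_liftLabel]
  have h : IsSubst ρ S S T :=
    ⟨fun y hy => absurd (Subsingleton.elim _ _) hy, fun k => by rw [hρ, hl]⟩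
  have ha : collapseWeight ρ a = a := by
    funext k
    apply PNat.eq
    rw [collapseWeight_eq_sum]
    simp [hρ]
  rw [graft_eq h, hy, ha, energy_of_subsingleton T]
  simp

end Graft

/-! ### Associativity -/

/-- Subtraction on `ℕ` is truncated, so the four inequalities are needed to compare the total
exponents. -/
theorem pow_sub_mul_pow_sub (lam : K) {a b a' b' d e d' e' : ℕ} (h₁ : b ≤ a) (h₂ : e ≤ d)
    (h₃ : b' ≤ a') (h₄ : e' ≤ d') (h : a + d + (b' + e') = a' + d' + (b + e)) :
    lam ^ (a - b) * lam ^ (d - e) = lam ^ (a' - b') * lam ^ (d' - e') := by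
  rw [← pow_add, ← pow_add]
  congr 1
  omega

section Assoc

variable {I J N M Q L : Type} [DecidableEq I] [DecidableEq J] [DecidableEq N]
  [DecidableEq M] [DecidableEq Q] [DecidableEq L]
  {v : I} {j : J} {w : N} {ρ₁ : {x : N // x ≠ w} ⊕ Q ≃ L} {ρ₂ : {x : I // x ≠ v} ⊕ J ≃ N}
  {ρ₃ : {x : I // x ≠ v} ⊕ M ≃ L} {ρ₄ : {x : J // x ≠ j} ⊕ Q ≃ M}
  {U : LabelledRootedTree L} {U' : LabelledRootedTree N} {V : LabelledRootedTree M}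
  {X : LabelledRootedTree I} {Y : LabelledRootedTree J} {Z : LabelledRootedTree Q}

section

variable (h₁ : ∀ k, collapse ρ₂ (collapse ρ₁ k) = collapse ρ₃ k)
  (h₂ : ∀ q, ρ₁ (Sum.inr q) = ρ₃ (Sum.inr (ρ₄ (Sum.inr q))))
  (h₃ : ∀ k, collapse ρ₁ (ρ₃ (Sum.inr k)) = ρ₂ (Sum.inr (collapse ρ₄ k)))

include h₂ h₃

omit [DecidableEq I] [DecidableEq M] [DecidableEq Q] [DecidableEq L] in
theorem inr_liftLabel (r : Q) (y : J) :
    ρ₃ (Sum.inr (liftLabel ρ₄ r y)) = liftLabel ρ₁ r (ρ₂ (Sum.inr y)) := by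
  have hk : ∀ q, q ≠ r → ρ₃ (Sum.inr (liftLabel ρ₄ r y)) ≠ ρ₁ (Sum.inr q) := by
    intro q hq h
    rw [h₂] at h
    exact liftLabel_ne_inr hq y (inr_injective h)
  rw [eq_liftLabel hk, h₃, collapse_liftLabel]

include h₁

omit [DecidableEq M] [DecidableEq Q] [DecidableEq L] in
theorem liftLabel_liftLabel (r : Q) (s : J) (x : I) :
    liftLabel ρ₃ (liftLabel ρ₄ r s) x = liftLabel ρ₁ r (liftLabel ρ₂ s x) := by
  have hk : ∀ m, m ≠ liftLabel ρ₄ r s →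
      liftLabel ρ₁ r (liftLabel ρ₂ s x) ≠ ρ₃ (Sum.inr m) := by
    intro m hm h
    have hc := congrArg (collapse ρ₁) h
    rw [collapse_liftLabel, h₃] at hc
    have hs : collapse ρ₄ m = s := by
      by_contra hne
      exact liftLabel_ne_inr hne x hc
    rcases eq_liftLabel_or ρ₄ r m with h' | ⟨q, hq, rfl⟩
    · exact hm (by rw [h', hs])
    · rw [← h₂] at h
      exact liftLabel_ne_inr hq _ h
  rw [eq_liftLabel hk, ← h₁, collapse_liftLabel, collapse_liftLabel]

omit [DecidableEq M] [DecidableEq L] in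
-- The block `Q` sits inside the block `M`, whose contraction along `Q` is `J`. The tree `V` is what
-- `U` induces on `M`, the edge leaving the root of `M` being dropped.
theorem exists_nested_inner (hU : IsSubst ρ₁ U U' Z) (hU' : IsSubst ρ₂ U' X Y) :
    ∃ V, IsSubst ρ₃ U X V ∧ IsSubst ρ₄ V Y Z := by
  classical
  have hr : ∀ q, q ≠ Z.root → U.parent (ρ₃ (Sum.inr (ρ₄ (Sum.inr q)))) =
      ρ₃ (Sum.inr (ρ₄ (Sum.inr (Z.parent q)))) := fun q hq => by
    rw [← h₂, hU.parent_inr q hq, h₂]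
  have hs : ∀ y, y ≠ Y.root → collapse ρ₁ (U.parent (ρ₃ (Sum.inr (liftLabel ρ₄ Z.root y)))) =
      ρ₂ (Sum.inr (Y.parent y)) := fun y hy => by
    rw [inr_liftLabel h₂ h₃, hU.collapse_parent, hU'.parent_inr y hy]
  -- Only the root of the block may have its parent outside `M`; the implication allows an arbitrary
  -- value there, so that `choose` yields a total map.
  have hex : ∀ k, ∃ k', k ≠ liftLabel ρ₄ Z.root Y.root →
      U.parent (ρ₃ (Sum.inr k)) = ρ₃ (Sum.inr k') := by
    intro k
    by_cases hk : k = liftLabel ρ₄ Z.root Y.root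
    · exact ⟨k, fun h => absurd hk h⟩
    rcases eq_liftLabel_or ρ₄ Z.root k with h | ⟨q, hq, rfl⟩
    · have hy : collapse ρ₄ k ≠ Y.root := fun hc => hk (by rw [h, hc])
      have hv : collapse ρ₃ (U.parent (ρ₃ (Sum.inr k))) = v := by
        rw [← h₁, h, hs _ hy, collapse_inr]
      obtain ⟨k', hk'⟩ := exists_inr_of_collapse_eq hv
      exact ⟨k', fun _ => hk'.symm⟩
    · exact ⟨_, fun _ => hr q hq⟩
  choose p hp using hex
  -- The root is made a fixed point, as the convention on parent maps requires. Recognising the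
  -- shape of a substitution spares a separate proof that every vertex reaches the root.
  obtain ⟨f, hf⟩ := exists_subst_parent_eq (ρ := ρ₄) (S := Y) (T := Z)
    (p := fun k => if k = liftLabel ρ₄ Z.root Y.root then k else p k)
    (fun q hq => by
      have hne := (liftLabel_ne_inr (ρ := ρ₄) hq Y.root).symm
      simp only [hne, if_false]
      exact inr_injective (ρ := ρ₃) (by rw [← hp _ hne, hr q hq]))
    (fun y => by
      by_cases hy : y = Y.root
      · simp [hy, Y.parent_root]
      · have hne : liftLabel ρ₄ Z.root y ≠ liftLabel ρ₄ Z.root Y.root := fun h =>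
          hy (by simpa using congrArg (collapse ρ₄) h)
        simp only [hne, if_false]
        exact inr_injective (ρ := ρ₂) (by rw [← h₃, ← hp _ hne, hs y hy]))
    (by simp)
  have hV : IsSubst ρ₄ ((Y.subst j Z f).relabel ρ₄) Y Z := isSubst_subst f
  refine ⟨_, ⟨fun k hk => ?_, fun x => ?_⟩, hV⟩
  · rw [hV.root_eq] at hk
    rw [hf, hp k hk]
    simp [hk]
  · rw [hV.root_eq, liftLabel_liftLabel h₁ h₂ h₃, ← h₁, hU.collapse_parent, hU'.collapse_parent]

omit [DecidableEq M] [DecidableEq Q] [DecidableEq L] in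
-- Conversely, `Z` is already a subtree of `U`; contracting it first shrinks `V` to `Y` and leaves
-- the outer contraction equal to `X`.
theorem exists_nested_outer (hU : IsSubst ρ₃ U X V) (hV : IsSubst ρ₄ V Y Z) :
    ∃ U', IsSubst ρ₁ U U' Z ∧ IsSubst ρ₂ U' X Y := by
  have hr : ∀ q, q ≠ Z.root → U.parent (ρ₁ (Sum.inr q)) = ρ₁ (Sum.inr (Z.parent q)) := by
    intro q hq
    have hne : ρ₄ (Sum.inr q) ≠ V.root := by
      rw [hV.root_eq]
      exact (liftLabel_ne_inr hq _).symm
    rw [h₂, hU.parent_inr _ hne, hV.parent_inr q hq, h₂]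
  obtain ⟨U', hU'⟩ := exists_isSubst hr
  refine ⟨U', hU', fun y hy => ?_, fun x => ?_⟩
  · have hne : liftLabel ρ₄ Z.root y ≠ V.root := by
      rw [hV.root_eq]
      exact fun h => hy (by simpa using congrArg (collapse ρ₄) h)
    rw [← hU'.collapse_parent, ← inr_liftLabel h₂ h₃, hU.parent_inr _ hne, h₃,
      hV.collapse_parent]
  · rw [← hU'.collapse_parent, h₁, ← liftLabel_liftLabel h₁ h₂ h₃, ← hV.root_eq,
      hU.collapse_parent]

variable {K : Type u} [Field K] {lam : K} [Fintype I] [Fintype J] [Fintype N]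
  [Fintype M] [Fintype Q] [Fintype L]

/-- If `U` decomposes one way it decomposes the other way, with the same `X`, `Y`, `Z`, and
otherwise both sides vanish. In the exponents the energies of `U'` and `V` cancel. -/
theorem graft_nested (x : (I → ℕ+) → LabelledRootedTree I → K)
    (y : (J → ℕ+) → LabelledRootedTree J → K) (z : (Q → ℕ+) → LabelledRootedTree Q → K)
    (c : L → ℕ+) (U : LabelledRootedTree L) :
    graft lam ρ₁ (graft lam ρ₂ x y) z c U = graft lam ρ₃ x (graft lam ρ₄ y z) c U := by
  by_cases h : ∃ U' X Y Z, IsSubst ρ₁ U U' Z ∧ IsSubst ρ₂ U' X Y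
  · obtain ⟨U', X, Y, Z, hU, hU'⟩ := h
    obtain ⟨V, hV, hV'⟩ := exists_nested_inner h₁ h₂ h₃ hU hU'
    have : Nonempty J := ⟨Y.root⟩
    have : Nonempty Q := ⟨Z.root⟩
    have : Nonempty M := ⟨V.root⟩
    have e₁ : collapseWeight ρ₂ (collapseWeight ρ₁ c) = collapseWeight ρ₃ c :=
      collapseWeight_collapseWeight h₁ c
    have e₂ : blockWeight ρ₂ (collapseWeight ρ₁ c) = collapseWeight ρ₄ (blockWeight ρ₃ c) := by
      funext y
      apply PNat.eq
      rw [blockWeight, collapseWeight_eq_sum, collapseWeight_eq_sum, ← ρ₃.sum_comp,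
        Fintype.sum_sum_type, Finset.sum_eq_zero, zero_add]
      · refine Finset.sum_congr rfl fun k _ => ?_
        rw [h₃]
        exact if_congr ⟨inr_injective, fun h => by rw [h]⟩ rfl rfl
      · intro x _
        refine if_neg fun h => x.2 ?_
        rw [← collapse_inl ρ₃ x, ← h₁, h, collapse_inr]
    have e₃ : blockWeight ρ₁ c = blockWeight ρ₄ (blockWeight ρ₃ c) := by
      funext q
      rw [blockWeight, h₂]
      rfl
    have le₁ := hU.energy_add_le c
    have le₂ := hU'.energy_add_le (collapseWeight ρ₁ c)
    have le₃ := hV.energy_add_le c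
    have le₄ := hV'.energy_add_le (blockWeight ρ₃ c)
    rw [graft_eq hU, graft_eq hU', graft_eq hV, graft_eq hV']
    rw [e₁, e₂] at *
    rw [e₃] at *
    linear_combination (x (collapseWeight ρ₃ c) X * y (collapseWeight ρ₄ (blockWeight ρ₃ c)) Y *
      z (blockWeight ρ₄ (blockWeight ρ₃ c)) Z) * pow_sub_mul_pow_sub lam le₁ le₂ le₃ le₄ (by ring)
  · rw [graft_eq_zero, graft_eq_zero]
    · intro X V hU
      rw [graft_eq_zero, mul_zero]
      intro Y Z hV
      obtain ⟨U', hU'⟩ := exists_nested_outer h₁ h₂ h₃ hU hV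
      exact absurd ⟨U', X, Y, Z, hU'⟩ h
    · intro U' Z hU
      rw [graft_eq_zero, zero_mul]
      intro X Y hU'
      exact absurd ⟨U', X, Y, Z, hU, hU'⟩ h

end

end Assoc

/-! ### Disjoint associativity -/

section Disjoint

variable {I J N N' Q L : Type} [DecidableEq I] [DecidableEq J] [DecidableEq N]
  [DecidableEq N'] [DecidableEq Q] [DecidableEq L]
  {u v : I} {w : N} {w' : N'}
  {ρ₁ : {x : N // x ≠ w} ⊕ Q ≃ L} {ρ₂ : {x : I // x ≠ v} ⊕ J ≃ N}
  {ρ₃ : {x : N' // x ≠ w'} ⊕ J ≃ L} {ρ₄ : {x : I // x ≠ u} ⊕ Q ≃ N'}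
  {U : LabelledRootedTree L} {U' : LabelledRootedTree N}
  {X : LabelledRootedTree I} {Y : LabelledRootedTree J} {Z : LabelledRootedTree Q}

omit [DecidableEq I] [DecidableEq J] [DecidableEq N] [DecidableEq N'] [DecidableEq Q]
  [DecidableEq L] in
theorem inr_ne_inr_of_disjoint (huv : u ≠ v)
    (h₁ : ∀ k, collapse ρ₂ (collapse ρ₁ k) = collapse ρ₄ (collapse ρ₃ k))
    (h₂ : ∀ y, collapse ρ₁ (ρ₃ (Sum.inr y)) = ρ₂ (Sum.inr y))
    (h₃ : ∀ q, collapse ρ₃ (ρ₁ (Sum.inr q)) = ρ₄ (Sum.inr q)) (y : J) (q : Q) :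
    ρ₃ (Sum.inr y) ≠ ρ₁ (Sum.inr q) := by
  intro h
  have := h₁ (ρ₁ (Sum.inr q))
  rw [h₃, ← h, h₂, collapse_inr, collapse_inr] at this
  exact huv this.symm

omit [DecidableEq I] [DecidableEq J] [DecidableEq N] [DecidableEq N'] [DecidableEq Q]
  [DecidableEq L] in
theorem inr_ne_of_disjoint (huv : u ≠ v)
    (h₁ : ∀ k, collapse ρ₂ (collapse ρ₁ k) = collapse ρ₄ (collapse ρ₃ k))
    (h₂ : ∀ y, collapse ρ₁ (ρ₃ (Sum.inr y)) = ρ₂ (Sum.inr y))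
    (h₃ : ∀ q, collapse ρ₃ (ρ₁ (Sum.inr q)) = ρ₄ (Sum.inr q)) (y : J) :
    ρ₂ (Sum.inr y) ≠ w := by
  intro h
  rw [← h₂] at h
  obtain ⟨q, hq⟩ := exists_inr_of_collapse_eq h
  exact inr_ne_inr_of_disjoint huv h₁ h₂ h₃ y q hq.symm

omit [DecidableEq J] [DecidableEq Q] [DecidableEq L] in
-- Contracting `Z` does not touch the block of `Y`, so `Y` is already a subtree of `U` and can be
-- contracted first. The hypotheses are symmetric in the two blocks, so the same lemma gives the
-- converse.
theorem exists_disjoint (huv : u ≠ v)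
    (h₁ : ∀ k, collapse ρ₂ (collapse ρ₁ k) = collapse ρ₄ (collapse ρ₃ k))
    (h₂ : ∀ y, collapse ρ₁ (ρ₃ (Sum.inr y)) = ρ₂ (Sum.inr y))
    (h₃ : ∀ q, collapse ρ₃ (ρ₁ (Sum.inr q)) = ρ₄ (Sum.inr q))
    (hU : IsSubst ρ₁ U U' Z) (hU' : IsSubst ρ₂ U' X Y) :
    ∃ V, IsSubst ρ₃ U V Y ∧ IsSubst ρ₄ V X Z := by
  have hne := inr_ne_inr_of_disjoint huv h₁ h₂ h₃
  have hw := inr_ne_of_disjoint huv h₁ h₂ h₃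
  have hr : ∀ y, y ≠ Y.root → U.parent (ρ₃ (Sum.inr y)) = ρ₃ (Sum.inr (Y.parent y)) := by
    intro y hy
    have hp := hU.parent_collapse (k := ρ₃ (Sum.inr y)) fun q _ => hne y q
    rw [h₂, hU'.parent_inr y hy] at hp
    refine eq_of_collapse_eq (ρ := ρ₁) ?_ ?_
    · rw [← hp, h₂]
    · rw [h₂]
      exact hw _
  obtain ⟨V, hV⟩ := exists_isSubst hr
  refine ⟨V, hV, fun q hq => ?_, fun x => ?_⟩
  · rw [← h₃, hV.parent_collapse fun y _ => (hne y q).symm, hU.parent_inr q hq, h₃]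
  -- `k` is the common lift of `x` to `U`: it is a non-root vertex of neither block, so its outgoing
  -- edge survives both contractions in either order.
  · set k := liftLabel ρ₃ Y.root (liftLabel ρ₄ Z.root x) with hk
    have hk₃ : ∀ y, y ≠ Y.root → k ≠ ρ₃ (Sum.inr y) := fun y hy => liftLabel_ne_inr hy _
    have hk₁ : ∀ q, q ≠ Z.root → k ≠ ρ₁ (Sum.inr q) := by
      intro q hq h
      have := congrArg (collapse ρ₃) h
      rw [hk, collapse_liftLabel, h₃] at this
      exact liftLabel_ne_inr hq _ this
    have hk₂ : ∀ y, y ≠ Y.root → collapse ρ₁ k ≠ ρ₂ (Sum.inr y) := by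
      intro y hy h
      rw [← h₂] at h
      exact hk₃ y hy (eq_of_collapse_eq h (by rw [h₂]; exact hw y))
    rw [← hV.collapse_parent, ← hk, ← h₁, ← hU.parent_collapse hk₁, ← hU'.parent_collapse hk₂,
      h₁, hk, collapse_liftLabel, collapse_liftLabel]

variable {K : Type u} [Field K] {lam : K} [Fintype I] [Fintype J] [Fintype N]
  [Fintype N'] [Fintype Q] [Fintype L]

theorem graft_disjoint (huv : u ≠ v)
    (h₁ : ∀ k, collapse ρ₂ (collapse ρ₁ k) = collapse ρ₄ (collapse ρ₃ k))
    (h₂ : ∀ y, collapse ρ₁ (ρ₃ (Sum.inr y)) = ρ₂ (Sum.inr y))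
    (h₃ : ∀ q, collapse ρ₃ (ρ₁ (Sum.inr q)) = ρ₄ (Sum.inr q))
    (x : (I → ℕ+) → LabelledRootedTree I → K)
    (y : (J → ℕ+) → LabelledRootedTree J → K) (z : (Q → ℕ+) → LabelledRootedTree Q → K)
    (c : L → ℕ+) (U : LabelledRootedTree L) :
    graft lam ρ₁ (graft lam ρ₂ x y) z c U = graft lam ρ₃ (graft lam ρ₄ x z) y c U := by
  by_cases h : ∃ U' X Y Z, IsSubst ρ₁ U U' Z ∧ IsSubst ρ₂ U' X Y
  · obtain ⟨U', X, Y, Z, hU, hU'⟩ := h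
    obtain ⟨V, hV, hV'⟩ := exists_disjoint huv h₁ h₂ h₃ hU hU'
    have : Nonempty J := ⟨Y.root⟩
    have : Nonempty Q := ⟨Z.root⟩
    have e₁ : collapseWeight ρ₂ (collapseWeight ρ₁ c) =
        collapseWeight ρ₄ (collapseWeight ρ₃ c) := by
      funext x
      apply PNat.eq
      rw [collapseWeight_eq_sum, sum_ite_collapseWeight, collapseWeight_eq_sum,
        sum_ite_collapseWeight]
      simp only [h₁]
    have e₂ : blockWeight ρ₂ (collapseWeight ρ₁ c) = blockWeight ρ₃ c := by
      funext y
      rw [blockWeight, ← h₂, collapseWeight_collapse]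
      · rfl
      · rw [h₂]
        exact inr_ne_of_disjoint huv h₁ h₂ h₃ y
    have e₃ : blockWeight ρ₄ (collapseWeight ρ₃ c) = blockWeight ρ₁ c := by
      funext q
      rw [blockWeight, ← h₃, collapseWeight_collapse]
      · rfl
      · rw [h₃]
        exact inr_ne_of_disjoint huv.symm (fun k => (h₁ k).symm) h₃ h₂ q
    have le₁ := hU.energy_add_le c
    have le₂ := hU'.energy_add_le (collapseWeight ρ₁ c)
    have le₃ := hV.energy_add_le c
    have le₄ := hV'.energy_add_le (collapseWeight ρ₃ c)
    rw [graft_eq hU, graft_eq hU', graft_eq hV, graft_eq hV', e₁, e₂, e₃]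
    rw [e₁, e₂] at le₂
    rw [e₃] at le₄
    linear_combination (x (collapseWeight ρ₄ (collapseWeight ρ₃ c)) X * y (blockWeight ρ₃ c) Y *
      z (blockWeight ρ₁ c) Z) * pow_sub_mul_pow_sub lam le₁ le₂ le₃ le₄ (by ring)
  · rw [graft_eq_zero, graft_eq_zero]
    · intro V Y hV
      rw [graft_eq_zero, zero_mul]
      intro X Z hV'
      obtain ⟨U', hU, hU'⟩ := exists_disjoint huv.symm (fun k => (h₁ k).symm) h₃ h₂ hV hV'
      exact absurd ⟨U', X, Y, Z, hU, hU'⟩ h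
    · intro U' Z hU
      rw [graft_eq_zero, zero_mul]
      intro X Y hU'
      exact absurd ⟨U', X, Y, Z, hU, hU'⟩ h

end Disjoint

/-! ## Labels and weights of partial compositions -/

theorem insertEquiv_inr_val {n m : ℕ} (i : Fin n) (y : Fin m) :
    (insertEquiv m i (Sum.inr y) : ℕ) = i + y := rfl

theorem collapse_insertEquiv_val {n m : ℕ} (i : Fin n) (k : Fin (n + m - 1)) :
    (collapse (insertEquiv m i) k).val =
      if (k : ℕ) < i then (k : ℕ) else if (k : ℕ) < i + m then (i : ℕ) else k + 1 - m := by
  simp only [collapse, insertEquiv, Equiv.coe_fn_symm_mk]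
  split_ifs <;> rfl

/-- Insertion discards the outer weight at `i`, so no condition on `c` is needed, even for an empty
block. -/
theorem insertDegree_outerDegree_innerDegree {n m : ℕ} (i : Fin n) (c : Fin (n + m - 1) → ℕ+) :
    insertDegree i (outerDegree (m := m) i c) (innerDegree i c) = c := by
  funext k
  obtain ⟨z, rfl⟩ := (insertEquiv m i).surjective k
  rcases z with ⟨x, hx⟩ | y
  · simp [insertDegree, outerDegree, hx]
  · simp [insertDegree, innerDegree]

theorem innerDegree_insertDegree {n m : ℕ} (i : Fin n) (a : Fin n → ℕ+) (b : Fin m → ℕ+) :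
    innerDegree i (insertDegree i a b) = b := by
  funext y
  simp [insertDegree, innerDegree]

theorem outerDegree_insertDegree {n m : ℕ} {i : Fin n} {a : Fin n → ℕ+} {b : Fin m → ℕ+}
    (h : totalDegree b = a i) : outerDegree (m := m) i (insertDegree i a b) = a := by
  funext x
  by_cases hx : x = i
  · subst hx
    simp [outerDegree, innerDegree_insertDegree, h]
  · simp [outerDegree, hx, insertDegree]

theorem totalDegree_innerDegree {n m : ℕ} [Nonempty (Fin m)] (i : Fin n)
    (c : Fin (n + m - 1) → ℕ+) :
    totalDegree (innerDegree (m := m) i c) = outerDegree (m := m) i c i :=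
  (collapseWeight_self (insertEquiv m i) c).symm

/-! ## The compositions of the deformed operad -/

theorem bilinearExtension_apply {n m l : ℕ}
    (w : LabelledRootedTree (Fin n) → LabelledRootedTree (Fin m) → TreeSpace K l)
    (s : TreeSpace K n) (t : TreeSpace K m) :
    bilinearExtension w s t = ∑ S, ∑ T, (s S * t T) • w S T := by
  rw [bilinearExtension, Finsupp.linearCombination_apply, Finsupp.sum_fintype _ _ (by simp),
    LinearMap.sum_apply]
  refine Finset.sum_congr rfl fun S _ => ?_
  rw [LinearMap.smul_apply, Finsupp.linearCombination_apply, Finsupp.sum_fintype _ _ (by simp),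
    Finset.smul_sum]
  simp only [smul_smul]

theorem bilinearExtension_single {n m l : ℕ}
    (w : LabelledRootedTree (Fin n) → LabelledRootedTree (Fin m) → TreeSpace K l)
    (S : LabelledRootedTree (Fin n)) (T : LabelledRootedTree (Fin m)) :
    bilinearExtension w (Finsupp.single S 1) (Finsupp.single T 1) = w S T := by
  simp [bilinearExtension]

theorem bilinearExtension_congr {n m l : ℕ}
    {w w' : LabelledRootedTree (Fin n) → LabelledRootedTree (Fin m) → TreeSpace K l}
    (h : ∀ S T, w S T = w' S T) : bilinearExtension w = bilinearExtension w' := by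
  rw [funext fun S => funext (h S)]

theorem deformedData_comp_apply (lam : K) {n m : ℕ} (i : Fin n) (x : WeightedTreeSpace K n)
    (y : WeightedTreeSpace K m) (c : Fin (n + m - 1) → ℕ+) :
    ((deformedData lam).comp i x y : WeightedTreeSpace K (n + m - 1)) c = bilinearExtension
      (fun S T => weightedTreeComp lam i S (outerDegree (m := m) i c) T (innerDegree i c) c)
      (x (outerDegree (m := m) i c)) (y (innerDegree i c)) := rfl

theorem weightedTreeComp_insertDegree (lam : K) {n m : ℕ} {i : Fin n} {a : Fin n → ℕ+}
    {b : Fin m → ℕ+} (h : totalDegree b = a i) (S : LabelledRootedTree (Fin n))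
    (T : LabelledRootedTree (Fin m)) :
    weightedTreeComp lam i S a T b (insertDegree i a b) =
      ∑ f : S.Incoming i → Fin m,
        insertCoeff lam i S a T b f • Finsupp.single (treeInsert i S T f) (1 : K) := by
  rw [weightedTreeComp, if_pos h, Finset.sum_apply]
  simp [weightedTree]

theorem weightedTreeComp_apply (lam : K) {n m : ℕ} (i : Fin n) (S : LabelledRootedTree (Fin n))
    (T : LabelledRootedTree (Fin m)) (c : Fin (n + m - 1) → ℕ+) :
    weightedTreeComp lam i S (outerDegree (m := m) i c) T (innerDegree i c) c =
      ∑ f : S.Incoming i → Fin m,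
        insertCoeff lam i S (outerDegree (m := m) i c) T (innerDegree i c) f •
          Finsupp.single (treeInsert i S T f) (1 : K) := by
  have : Nonempty (Fin m) := ⟨T.root⟩
  conv_lhs => rw [← insertDegree_outerDegree_innerDegree (m := m) i c]
  rw [innerDegree_insertDegree, outerDegree_insertDegree (totalDegree_innerDegree i c),
    weightedTreeComp_insertDegree lam (totalDegree_innerDegree i c)]

theorem insertCoeff_eq (lam : K) {n m : ℕ} (i : Fin n) (S : LabelledRootedTree (Fin n))
    (T : LabelledRootedTree (Fin m)) (c : Fin (n + m - 1) → ℕ+) (f : S.Incoming i → Fin m) :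
    insertCoeff lam i S (outerDegree (m := m) i c) T (innerDegree i c) f =
      lam ^ ((treeInsert i S T f).energy c -
        (S.energy (collapseWeight (insertEquiv m i) c) +
          T.energy (blockWeight (insertEquiv m i) c))) := by
  rw [insertCoeff, insertEnergy, insertEnergy, insertDegree_outerDegree_innerDegree]
  congr 2
  exact energy_subst_toRoot c

/-! ### Operad axioms through coefficients -/

/-- The coefficient of an element of the deformed operad at a weighted tree. -/
def treeCoeff {lam : K} {n : ℕ} (x : (deformedData lam).carrier n) (c : Fin n → ℕ+)
    (S : LabelledRootedTree (Fin n)) : K :=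
  (show WeightedTreeSpace K n from x) c S

theorem treeCoeff_ext {lam : K} {n : ℕ} {x y : (deformedData lam).carrier n}
    (h : ∀ c S, treeCoeff x c S = treeCoeff y c S) : x = y :=
  funext fun c => Finsupp.ext (h c)

/-- At a tree `U`, the sum over `f` has at most one nonzero term, because distinct reattachments
give distinct trees. -/
theorem treeCoeff_comp {lam : K} {n m : ℕ} (i : Fin n) (x : (deformedData lam).carrier n)
    (y : (deformedData lam).carrier m) :
    treeCoeff ((deformedData lam).comp i x y) =
      graft lam (insertEquiv m i) (treeCoeff x) (treeCoeff y) := by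
  funext c U
  change bilinearExtension
      (fun S T => weightedTreeComp lam i S (outerDegree (m := m) i c) T (innerDegree i c) c)
      ((x : WeightedTreeSpace K n) (outerDegree (m := m) i c))
      ((y : WeightedTreeSpace K m) (innerDegree i c)) U = _
  classical
  rw [bilinearExtension_apply, graft, Finsupp.finsetSum_apply]
  refine Finset.sum_congr rfl fun S _ => ?_
  rw [Finsupp.finsetSum_apply]
  refine Finset.sum_congr rfl fun T _ => ?_
  rw [weightedTreeComp_apply, Finsupp.smul_apply, Finsupp.finsetSum_apply]
  split_ifs with h
  · obtain ⟨f, rfl⟩ := h.exists_subst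
    rw [Finset.sum_eq_single f]
    · rw [insertCoeff_eq]
      simp only [treeInsert, Finsupp.smul_apply, Finsupp.single_eq_same, smul_eq_mul, mul_one]
      rw [mul_comm]
      rfl
    · intro g _ hg
      rw [Finsupp.smul_apply, Finsupp.single_eq_of_ne, smul_zero]
      exact fun h => hg (subst_injective h.symm)
    · simp
  · rw [Finset.sum_eq_zero, smul_zero]
    intro f _
    rw [Finsupp.smul_apply, Finsupp.single_eq_of_ne, smul_zero]
    rintro rfl
    exact h (isSubst_subst f)

theorem treeAct_apply {n : ℕ} (σ : Equiv.Perm (Fin n)) (t : TreeSpace K n)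
    (S : LabelledRootedTree (Fin n)) : treeAct σ t S = t (S.relabel σ) := by
  conv_lhs => rw [← relabel_symm_relabel σ S]
  exact Finsupp.mapDomain_apply (relabelEquiv σ.symm).injective _ _

theorem treeCoeff_act {lam : K} {n : ℕ} (σ : Equiv.Perm (Fin n))
    (x : (deformedData lam).carrier n) (c : Fin n → ℕ+) (S : LabelledRootedTree (Fin n)) :
    treeCoeff ((deformedData lam).act σ x) c S = treeCoeff x (c ∘ σ.symm) (S.relabel σ) :=
  treeAct_apply σ _ S

/-- The identification of arities is absorbed into the labelling; `graft` allows an arbitrary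
labelling for this purpose. -/
theorem treeCoeff_castArity_comp {lam : K} {n m l : ℕ} (h : n + m - 1 = l) (i : Fin n)
    (x : (deformedData lam).carrier n) (y : (deformedData lam).carrier m) :
    treeCoeff ((deformedData lam).castArity h ((deformedData lam).comp i x y)) =
      graft lam ((insertEquiv m i).trans (finCongr h)) (treeCoeff x) (treeCoeff y) := by
  subst h
  exact treeCoeff_comp i x y

theorem treeCoeff_unit {lam : K} (c : Fin 1 → ℕ+) (S : LabelledRootedTree (Fin 1)) :
    treeCoeff (deformedData lam).unit c S = 1 := by
  rw [Subsingleton.elim S dot]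
  exact Finsupp.single_eq_same

theorem deformedData_isOperad (lam : K) : (deformedData lam).IsOperad where
  act_one x := treeCoeff_ext fun c S => treeCoeff_act 1 x c S
  act_mul σ τ x := treeCoeff_ext fun c S => by
    rw [treeCoeff_act, treeCoeff_act, treeCoeff_act]
    rfl
  nested_assoc {n m l} i j x y z := treeCoeff_ext fun c U => by
    have hi := i.2
    have hj := j.2
    rw [treeCoeff_castArity_comp, treeCoeff_comp, treeCoeff_comp, treeCoeff_comp]
    -- What remains are identities between insertion and collapse maps on `Fin`, checked on values
    -- by cases on the position relative to the blocks.
    refine graft_nested ?_ ?_ ?_ _ _ _ c U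
    · intro k
      apply Fin.ext
      simp only [collapse_trans, collapse_insertEquiv_val, finCongr_symm, finCongr_apply,
        Fin.val_cast]
      (repeat' split) <;> omega
    · intro q
      apply Fin.ext
      simp only [Equiv.trans_apply, finCongr_apply, Fin.val_cast, insertEquiv_inr_val]
      omega
    · intro k
      apply Fin.ext
      simp only [collapse_trans, collapse_insertEquiv_val, finCongr_symm, finCongr_apply,
        Fin.val_cast, insertEquiv_inr_val]
      grind
  disjoint_assoc {n m l} i j hij x y z := treeCoeff_ext fun c U => by
    have hi := i.2
    have hj := j.2
    have hij' : i.1 < j.1 := hij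
    rw [treeCoeff_castArity_comp, treeCoeff_comp, treeCoeff_comp, treeCoeff_comp]
    refine graft_disjoint (ne_of_gt hij) ?_ ?_ ?_ _ _ _ c U
    · intro k
      apply Fin.ext
      simp only [collapse_trans, collapse_insertEquiv_val, finCongr_symm, finCongr_apply,
        Fin.val_cast]
      (repeat' split) <;> omega
    · intro y
      apply Fin.ext
      simp only [collapse_trans, collapse_insertEquiv_val, finCongr_symm, finCongr_apply,
        Fin.val_cast, insertEquiv_inr_val]
      grind
    · intro q
      apply Fin.ext
      simp only [collapse_insertEquiv_val, Equiv.trans_apply, finCongr_apply,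
        Fin.val_cast, insertEquiv_inr_val]
      grind
  unit_comp {m} x := treeCoeff_ext fun c T => by
    rw [treeCoeff_castArity_comp]
    refine graft_unit_left (fun y => ?_) treeCoeff_unit c T dot
    apply Fin.ext
    simp [insertEquiv_inr_val]
  comp_unit {n} i x := treeCoeff_ext fun c S => by
    rw [treeCoeff_castArity_comp]
    refine graft_unit_right (fun k => ?_) treeCoeff_unit c S dot
    apply Fin.ext
    simp only [collapse_trans, collapse_insertEquiv_val, finCongr_symm, finCongr_apply,
      Fin.val_cast]
    split_ifs <;> omega
  equivariant {n m} i σ τ x y := treeCoeff_ext fun c U => by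
    rw [treeCoeff_comp, treeCoeff_act, treeCoeff_comp]
    refine graft_relabel (e := blockPerm i σ τ) (σ := σ) (τ := τ) (fun k => ?_) (fun y => ?_)
      (treeCoeff_act σ x) (treeCoeff_act τ y)
    · obtain ⟨z, rfl⟩ := (insertEquiv m i).surjective k
      rcases z with z | z <;> simp [blockPerm]
    · simp [blockPerm]

/-! ## The multigrading -/

theorem deformedData_comp_single (lam : K) {n m : ℕ} {i : Fin n} {a : Fin n → ℕ+}
    {b : Fin m → ℕ+} (h : totalDegree b = a i) (s : TreeSpace K n) (t : TreeSpace K m) :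
    (deformedData lam).comp i (Pi.single a s : WeightedTreeSpace K n)
        (Pi.single b t : WeightedTreeSpace K m) =
      (Pi.single (insertDegree i a b) (bilinearExtension
        (fun S T => weightedTreeComp lam i S a T b (insertDegree i a b)) s t) :
        WeightedTreeSpace K (n + m - 1)) := by
  refine funext fun c => (deformedData_comp_apply lam i _ _ c).trans ?_
  by_cases hc : c = insertDegree i a b
  · subst hc
    rw [innerDegree_insertDegree, outerDegree_insertDegree h]
    simp
  · rw [Pi.single_eq_of_ne hc]
    by_cases ha : outerDegree (m := m) i c = a
    · have hb : innerDegree (m := m) i c ≠ b := by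
        rintro rfl
        exact hc (by rw [← ha, insertDegree_outerDegree_innerDegree])
      rw [Pi.single_eq_of_ne hb, map_zero]
    · rw [Pi.single_eq_of_ne ha, map_zero, LinearMap.zero_apply]

theorem treeSpace_eq_zero_of_isEmpty {n : ℕ} [IsEmpty (Fin n)] (t : TreeSpace K n) : t = 0 :=
  Finsupp.ext fun T => isEmptyElim T.root

theorem deformedMultigrading_mem_homogeneous {lam : K} {n : ℕ} {a : Fin n → ℕ+}
    {x : (deformedData lam).carrier n} :
    x ∈ (deformedMultigrading lam).homogeneous a ↔
      ∀ b, b ≠ a → (x : WeightedTreeSpace K n) b = 0 := Iff.rfl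

theorem deformedData_comp_apply_eq_zero {lam : K} {n m : ℕ} {i : Fin n} {a : Fin n → ℕ+}
    {b : Fin m → ℕ+} {x : (deformedData lam).carrier n} {y : (deformedData lam).carrier m}
    (hx : x ∈ (deformedMultigrading lam).homogeneous a)
    (hy : y ∈ (deformedMultigrading lam).homogeneous b) (c : Fin (n + m - 1) → ℕ+)
    (h : ¬ (c = insertDegree i a b ∧ totalDegree b = a i)) :
    ((deformedData lam).comp i x y : WeightedTreeSpace K (n + m - 1)) c = 0 := by
  rw [deformedMultigrading_mem_homogeneous] at hx hy
  refine (deformedData_comp_apply lam i _ _ c).trans ?_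
  by_cases ha : outerDegree (m := m) i c = a
  · by_cases hb : innerDegree (m := m) i c = b
    -- An empty block has total weight `0` while `outerDegree` is `1` at `i`, so the weight
    -- condition fails; but there is no tree without vertices.
    · rcases isEmpty_or_nonempty (Fin m) with hm | hm
      · rw [treeSpace_eq_zero_of_isEmpty ((y : WeightedTreeSpace K m) _), map_zero]
      · refine absurd ⟨?_, ?_⟩ h
        · rw [← ha, ← hb, insertDegree_outerDegree_innerDegree]
        · rw [← ha, ← hb, totalDegree_innerDegree]
    · rw [hy _ hb, map_zero]
  · rw [hx _ ha, map_zero, LinearMap.zero_apply]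

theorem deformedData_act_mem {lam : K} {n : ℕ} (σ : Equiv.Perm (Fin n)) {a : Fin n → ℕ+}
    {x : (deformedData lam).carrier n} (hx : x ∈ (deformedMultigrading lam).homogeneous a) :
    (deformedData lam).act σ x ∈ (deformedMultigrading lam).homogeneous (a ∘ σ) := by
  intro c hc
  have h : (x : WeightedTreeSpace K n) (c ∘ σ.symm) = 0 := hx _ fun h => hc (by
    rw [← h, Function.comp_assoc, Equiv.symm_comp_self, Function.comp_id])
  exact (congrArg (treeAct σ) h).trans (map_zero _)

theorem deformedMultigrading_isMultigraded (lam : K) :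
    (deformedMultigrading lam).IsMultigraded where
  isOperad := deformedData_isOperad lam
  map_act σ a := by
    refine le_antisymm ?_ fun y hy => ?_
    · rintro _ ⟨x, hx, rfl⟩
      exact deformedData_act_mem σ hx
    · refine ⟨(deformedData lam).act σ⁻¹ y, ?_, ?_⟩
      · have := deformedData_act_mem σ⁻¹ hy
        have ha : (fun k => a (σ k)) ∘ ⇑σ⁻¹ = a := by
          funext k
          simp
        rwa [ha] at this
      · rw [← (deformedData_isOperad lam).act_mul, inv_mul_cancel,
          (deformedData_isOperad lam).act_one]
  comp_mem i a b x y hx hy := fun c hc =>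
    deformedData_comp_apply_eq_zero hx hy c fun h => hc h.1
  comp_eq_zero i a b x y hx hy h := funext fun c =>
    deformedData_comp_apply_eq_zero hx hy c fun h' => h h'.2

theorem deformedData_comp_weightedTree (lam : K) {n m : ℕ} (i : Fin n)
    (S : LabelledRootedTree (Fin n)) (a : Fin n → ℕ+) (T : LabelledRootedTree (Fin m))
    (b : Fin m → ℕ+) :
    (deformedData lam).comp i (weightedTree S a) (weightedTree T b) =
      weightedTreeComp lam i S a T b := by
  by_cases h : totalDegree b = a i
  · refine (deformedData_comp_single lam h _ _).trans ?_
    rw [bilinearExtension_single]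
    refine funext fun c => ?_
    by_cases hc : c = insertDegree i a b
    · rw [hc, Pi.single_eq_same]
    · rw [Pi.single_eq_of_ne hc, weightedTreeComp, if_pos h, Finset.sum_apply]
      simp [weightedTree, Pi.single_eq_of_ne hc]
  · rw [weightedTreeComp, if_neg h]
    refine (deformedMultigrading_isMultigraded lam).comp_eq_zero i a b _ _ ?_ ?_ h
    · exact fun c hc => Pi.single_eq_of_ne hc _
    · exact fun c hc => Pi.single_eq_of_ne hc _

theorem deformedData_part_comp (lam : K) {n m : ℕ} (i : Fin n) (a : Fin n → ℕ+)
    (b : Fin m → ℕ+) (h : totalDegree b = a i) (x : (deformedData lam).carrier n)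
    (y : (deformedData lam).carrier m) :
    (deformedMultigrading lam).part (insertDegree i a b) ((deformedData lam).comp i x y) =
      (deformedData lam).comp i ((deformedMultigrading lam).part a x)
        ((deformedMultigrading lam).part b y) := by
  refine Eq.trans ?_ (deformedData_comp_single lam h
    ((x : WeightedTreeSpace K n) a) ((y : WeightedTreeSpace K m) b)).symm
  refine congrArg (Pi.single (M := fun _ => TreeSpace K (n + m - 1)) (insertDegree i a b)) ?_
  refine (deformedData_comp_apply lam i x y _).trans ?_
  rw [innerDegree_insertDegree, outerDegree_insertDegree h]

/-! ## The pre-Lie operad and the operad NAP -/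

theorem insertEnergy_toRoot_le {n m : ℕ} (i : Fin n) (S : LabelledRootedTree (Fin n))
    (a : Fin n → ℕ+) (T : LabelledRootedTree (Fin m)) (b : Fin m → ℕ+)
    (f : S.Incoming i → Fin m) :
    insertEnergy i S a T b (S.toRoot i T) ≤ insertEnergy i S a T b f :=
  (isSubst_subst f).energy_subst_toRoot_le _

theorem insertCoeff_one {n m : ℕ} (i : Fin n) (S : LabelledRootedTree (Fin n))
    (a : Fin n → ℕ+) (T : LabelledRootedTree (Fin m)) (b : Fin m → ℕ+)
    (f : S.Incoming i → Fin m) : insertCoeff (1 : K) i S a T b f = 1 :=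
  one_pow _

theorem insertCoeff_toRoot (lam : K) {n m : ℕ} (i : Fin n) (S : LabelledRootedTree (Fin n))
    (a : Fin n → ℕ+) (T : LabelledRootedTree (Fin m)) (b : Fin m → ℕ+) :
    insertCoeff lam i S a T b (S.toRoot i T) = 1 := by
  rw [insertCoeff, Nat.sub_self, pow_zero]

theorem insertCoeff_zero_of_ne {n m : ℕ} {i : Fin n} {S : LabelledRootedTree (Fin n)}
    (a : Fin n → ℕ+) {T : LabelledRootedTree (Fin m)} (b : Fin m → ℕ+)
    {f : S.Incoming i → Fin m} (hf : f ≠ S.toRoot i T) :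
    insertCoeff (0 : K) i S a T b f = 0 :=
  zero_pow (Nat.sub_pos_of_lt (energy_subst_toRoot_lt _ hf)).ne'

theorem sum_insertCoeff_zero {n m : ℕ} (i : Fin n) (S : LabelledRootedTree (Fin n))
    (a : Fin n → ℕ+) (T : LabelledRootedTree (Fin m)) (b : Fin m → ℕ+) :
    ∑ f : S.Incoming i → Fin m,
      insertCoeff (0 : K) i S a T b f • Finsupp.single (treeInsert i S T f) (1 : K) =
    Finsupp.single (treeInsert i S T (S.toRoot i T)) 1 := by
  rw [Finset.sum_eq_single (S.toRoot i T), insertCoeff_toRoot, one_smul]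
  · intro f _ hf
    rw [insertCoeff_zero_of_ne a b hf, zero_smul]
  · simp

/-- The left side does not involve `c`: for `λ = 1` the composition is the same in every
multidegree, which gives both the componentwise comparison and the morphism. -/
theorem preLieData_comp_eq {n m : ℕ} (i : Fin n) (c : Fin (n + m - 1) → ℕ+) :
    (preLieData K).comp i = bilinearExtension (m := m) fun S T =>
      weightedTreeComp 1 i S (outerDegree (m := m) i c) T (innerDegree i c) c :=
  bilinearExtension_congr fun S T => by
    simp only [weightedTreeComp_apply, insertCoeff_one, one_smul]

theorem napData_comp_eq {n m : ℕ} (i : Fin n) (c : Fin (n + m - 1) → ℕ+) :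
    (napData K).comp i = bilinearExtension (m := m) fun S T =>
      weightedTreeComp 0 i S (outerDegree (m := m) i c) T (innerDegree i c) c :=
  bilinearExtension_congr fun S T => by
    rw [weightedTreeComp_apply, sum_insertCoeff_zero]

theorem preLieData_isMorphism :
    (preLieData K).IsMorphism (deformedData (1 : K)) (sumOverWeights K) where
  map_act _ _ := rfl
  map_unit := rfl
  map_comp i x y := funext fun c => by
    rw [preLieData_comp_eq i c]
    rfl

theorem napData_isMorphism :
    (napData K).IsMorphism (deformedData (0 : K)) (sumOverWeights K) where
  map_act _ _ := rfl
  map_unit := rfl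
  map_comp i x y := funext fun c => by
    rw [napData_comp_eq i c]
    rfl

theorem sumOverWeights_injective (n : ℕ) : Function.Injective (sumOverWeights K n) :=
  -- Any component recovers the original element; the one with all weights equal to `1` is used.
  fun _ _ h => congrFun h fun _ => 1

theorem preLieData_comp_single {n m : ℕ} {i : Fin n} {a : Fin n → ℕ+} {b : Fin m → ℕ+}
    (h : totalDegree b = a i) (s : TreeSpace K n) (t : TreeSpace K m) :
    (deformedData (1 : K)).comp i (Pi.single a s : WeightedTreeSpace K n)
        (Pi.single b t : WeightedTreeSpace K m) =
      (Pi.single (insertDegree i a b) ((preLieData K).comp i s t) :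
        WeightedTreeSpace K (n + m - 1)) := by
  rw [preLieData_comp_eq i (insertDegree i a b), innerDegree_insertDegree,
    outerDegree_insertDegree h]
  exact deformedData_comp_single 1 h s t

theorem napData_comp_single {n m : ℕ} {i : Fin n} {a : Fin n → ℕ+} {b : Fin m → ℕ+}
    (h : totalDegree b = a i) (s : TreeSpace K n) (t : TreeSpace K m) :
    (deformedData (0 : K)).comp i (Pi.single a s : WeightedTreeSpace K n)
        (Pi.single b t : WeightedTreeSpace K m) =
      (Pi.single (insertDegree i a b) ((napData K).comp i s t) :
        WeightedTreeSpace K (n + m - 1)) := by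
  rw [napData_comp_eq i (insertDegree i a b), innerDegree_insertDegree,
    outerDegree_insertDegree h]
  exact deformedData_comp_single 0 h s t

/-! ### Transfer of the operad axioms along an injective morphism -/

namespace OperadData

theorem map_castArity {P Q : OperadData K} (φ : ∀ n, P.carrier n →ₗ[K] Q.carrier n) {n m : ℕ}
    (h : n = m) (x : P.carrier n) : φ m (P.castArity h x) = Q.castArity h (φ n x) := by
  subst h
  rfl

/-- The axioms of an operad can be checked after an injective morphism. -/
theorem IsMorphism.isOperad_of_injective {P Q : OperadData K}
    {φ : ∀ n, P.carrier n →ₗ[K] Q.carrier n} (h : P.IsMorphism Q φ)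
    (hφ : ∀ n, Function.Injective (φ n)) (hQ : Q.IsOperad) : P.IsOperad where
  act_one x := hφ _ (by rw [h.map_act, hQ.act_one])
  act_mul σ τ x := hφ _ (by simp only [h.map_act, hQ.act_mul])
  nested_assoc i j x y z := hφ _ (by
    simp only [map_castArity, h.map_comp]
    exact hQ.nested_assoc i j _ _ _)
  disjoint_assoc i j hij x y z := hφ _ (by
    simp only [map_castArity, h.map_comp]
    exact hQ.disjoint_assoc i j hij _ _ _)
  unit_comp x := hφ _ (by
    simp only [map_castArity, h.map_comp, h.map_unit]
    exact hQ.unit_comp _)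
  comp_unit i x := hφ _ (by
    simp only [map_castArity, h.map_comp, h.map_unit]
    exact hQ.comp_unit i _)
  equivariant i σ τ x y := hφ _ (by
    simp only [h.map_comp, h.map_act]
    exact hQ.equivariant i σ τ _ _)

end OperadData

end

theorem mainTheorem1 {K : Type u} [Field K] :
    (∀ lam : K,
      -- the reattachment to the root has the smallest potential energy
      (∀ {n m : ℕ} (i : Fin n) (S : LabelledRootedTree (Fin n)) (a : Fin n → ℕ+)
        (T : LabelledRootedTree (Fin m)) (b : Fin m → ℕ+) (f : S.Incoming i → Fin m),
        insertEnergy i S a T b (S.toRoot i T) ≤ insertEnergy i S a T b f) ∧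
      -- the partial compositions of weighted trees are the prescribed ones
      (∀ {n m : ℕ} (i : Fin n) (S : LabelledRootedTree (Fin n)) (a : Fin n → ℕ+)
        (T : LabelledRootedTree (Fin m)) (b : Fin m → ℕ+),
        (deformedData lam).comp i (weightedTree S a) (weightedTree T b) =
          weightedTreeComp lam i S a T b) ∧
      -- and on infinite sums of weighted trees they are computed componentwise
      (∀ {n m : ℕ} (i : Fin n) (a : Fin n → ℕ+) (b : Fin m → ℕ+),
        totalDegree b = (a i : ℕ) →
        ∀ (x : (deformedData lam).carrier n) (y : (deformedData lam).carrier m),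
          (deformedMultigrading lam).part (insertDegree i a b) ((deformedData lam).comp i x y) =
            (deformedData lam).comp i ((deformedMultigrading lam).part a x)
              ((deformedMultigrading lam).part b y)) ∧
      -- they form a multigraded operad
      (deformedMultigrading lam).IsMultigraded) ∧
    -- forgetting the grading gives the pre-Lie operad for `λ = 1`
    ((preLieData K).IsOperad ∧
      (∀ {n m : ℕ} (i : Fin n) (a : Fin n → ℕ+) (b : Fin m → ℕ+),
        totalDegree b = (a i : ℕ) →
        ∀ (s : TreeSpace K n) (t : TreeSpace K m),
          (deformedData (1 : K)).comp i (Pi.single a s : WeightedTreeSpace K n)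
              (Pi.single b t : WeightedTreeSpace K m) =
            (Pi.single (insertDegree i a b) ((preLieData K).comp i s t) :
              WeightedTreeSpace K (n + m - 1))) ∧
      (preLieData K).IsMorphism (deformedData (1 : K)) (sumOverWeights K) ∧
      ∀ n, Function.Injective (sumOverWeights K n)) ∧
    -- and the operad NAP for `λ = 0`
    ((napData K).IsOperad ∧
      (∀ {n m : ℕ} (i : Fin n) (a : Fin n → ℕ+) (b : Fin m → ℕ+),
        totalDegree b = (a i : ℕ) →
        ∀ (s : TreeSpace K n) (t : TreeSpace K m),
          (deformedData (0 : K)).comp i (Pi.single a s : WeightedTreeSpace K n)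
              (Pi.single b t : WeightedTreeSpace K m) =
            (Pi.single (insertDegree i a b) ((napData K).comp i s t) :
              WeightedTreeSpace K (n + m - 1))) ∧
      (napData K).IsMorphism (deformedData (0 : K)) (sumOverWeights K) ∧
      ∀ n, Function.Injective (sumOverWeights K n)) :=
  ⟨fun lam => ⟨insertEnergy_toRoot_le, deformedData_comp_weightedTree lam,
      deformedData_part_comp lam, deformedMultigrading_isMultigraded lam⟩,
    ⟨preLieData_isMorphism.isOperad_of_injective sumOverWeights_injective
        (deformedData_isOperad 1),
      fun _ _ _ h => preLieData_comp_single h, preLieData_isMorphism, sumOverWeights_injective⟩,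
    napData_isMorphism.isOperad_of_injective sumOverWeights_injective (deformedData_isOperad 0),
    fun _ _ _ h => napData_comp_single h, napData_isMorphism, sumOverWeights_injective⟩
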